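/- Let $p$ be a prime, $e\ge 1$ and $q=p^e$. Let $\mathcal A_q$ be the algebra of Steenrod $q$th powers: the associative unital $\mathbb F_q$-algebra with generators $P^r$, $r\ge 0$, subject to $P^0=1$ and the Adem relations $$P^aP^b=\sum_{j=0}^{\lfloor a/q\rfloor}(-1)^{a+j}\binom{(q-1)(b-j)-1}{a-qj}P^{a+b-j}P^j\qquad (a<qb).$$ Let $\mathcal A_q^+$ be its augmentation ideal, the kernel of the $\mathbb F_q$-algebra homomorphism $\mathcal A_q\to\mathbb F_q$ with $P^r\mapsto 0$ for $r>0$. An element $\theta\in\mathcal A_q$ has May filtration $M(\theta)=m$ if $\theta\in(\mathcal A_q^+)^m$ but $\theta\notin(\mathcal A_q^+)^{m+1}$ (where $(\mathcal A_q^+)^0=\mathcal A_q$). The algebra $\mathcal A_q$ acts on $\mathbb F_q[x_1,x_2,\ldots]$, with $P^r(f)$ equal to the coefficient of $t^r$ in the image of $f$ under the $\mathbb F_q$-algebra homomorphism $x_j\mapsto x_j+t\,x_j^q$. For a finite sequence $R=(r_1,\ldots,r_\ell)$ of integers $\ge 0$, the Milnor basis element $P(R)\in\mathcal A_q$ is the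 unique element such that $P(R)(f)$ is, for every polynomial $f$, the coefficient of $t_1^{r_1}\cdots t_\ell^{r_\ell}$ in the image of $f$ under the $\mathbb F_q$-algebra homomorphism $x_j\mapsto x_j+\sum_{i=1}^{\ell}t_i\,x_j^{q^i}$. Let $\alpha(a)$ denote the sum of the base $p$ digits of $a$. Then for every $R=(r_1,\ldots,r_\ell)$ the element $P(R)$ exists and is unique, and has May filtration $$M(P(R))=\sum_{i=1}^{\ell} i\,\alpha(r_i).$$ In particular, for $s\ge 0$ and $t\ge 1$, the element $P^s_t=P(0,\ldots,0,p^s)$, with $p^s$ in position $t$, has May filtration $t$. -/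

import Mathlib

/-- The total Milnor operation, truncated at length `ℓ`: the homomorphism of `F`-algebras
`F[x₀, x₁, …] → F[x₀, x₁, …][t₁, …, t_ℓ]` with `x_j ↦ x_j + ∑ i, t_i x_j ^ (q ^ i)`, the sum over
`1 ≤ i ≤ ℓ`.  The variable `t_i` has index `i - 1` in `Fin ℓ`.  This is Milnor's coaction, with
`t_i` in the place of the `i`-th polynomial generator of the dual algebra. -/
noncomputable def milnorTotal (F : Type*) [Field F] (q ℓ : ℕ) :
    MvPolynomial ℕ F →ₐ[F] MvPolynomial (Fin ℓ) (MvPolynomial ℕ F) :=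
  MvPolynomial.aeval fun j =>
    MvPolynomial.C (MvPolynomial.X j) +
      ∑ i : Fin ℓ, MvPolynomial.X i * MvPolynomial.C (MvPolynomial.X j ^ q ^ (i.val + 1))

/-- The Milnor operation `P(R)`, `R = (r₁, …, r_ℓ)` (with `r_i` at index `i - 1`), on polynomials:
the coefficient of `t₁ ^ r₁ ⋯ t_ℓ ^ r_ℓ` in the total Milnor operation.  So `P(R)` is dual to the
monomial with exponent sequence `R` in the generators of the dual algebra. -/
noncomputable def milnorOp (F : Type*) [Field F] (q : ℕ) {ℓ : ℕ} (R : Fin ℓ → ℕ) :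
    Module.End F (MvPolynomial ℕ F) :=
  ((MvPolynomial.lcoeff (MvPolynomial ℕ F) (Finsupp.equivFunOnFinite.symm R)).restrictScalars F)
    ∘ₗ (milnorTotal F q ℓ).toLinearMap

/-- The Steenrod power `P^r = P(r)` on polynomials: the part of degree `r` in `t` of the algebra
homomorphism `x_j ↦ x_j + t x_j ^ q`. -/
noncomputable def steenrodOp (F : Type*) [Field F] (q r : ℕ) :
    Module.End F (MvPolynomial ℕ F) :=
  milnorOp F q ![r]


/-- Binomial coefficients with integral entries, in `F`; only used to verify the Adem relations. -/
noncomputable def intBinom (F : Type*) [Field F] (c d : ℤ) : F :=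
  if d < 0 then 0 else ((Ring.choose c d.toNat : ℤ) : F)

section
variable {F : Type*} [Field F]

theorem intBinom_neg (c : ℤ) {d : ℤ} (h : d < 0) : intBinom F c d = 0 := by
  simp [intBinom, h]

theorem intBinom_natCast (c : ℤ) (d : ℕ) :
    intBinom F c d = ((Ring.choose c d : ℤ) : F) := by
  simp [intBinom]

theorem intBinom_nat (c d : ℕ) : intBinom F c d = (c.choose d : F) := by
  rw [intBinom_natCast, Ring.choose_natCast]; simp

theorem intBinom_pascal (c d : ℤ) :
    intBinom F c d = intBinom F (c - 1) d + intBinom F (c - 1) (d - 1) := by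
  rcases lt_trichotomy d 0 with h | rfl | h
  · rw [intBinom_neg _ h, intBinom_neg _ h, intBinom_neg _ (by lia), add_zero]
  · simp [intBinom]
  · obtain ⟨k, rfl⟩ : ∃ k : ℕ, d = ((k + 1 : ℕ) : ℤ) := ⟨(d - 1).toNat, by lia⟩
    have h1 : (((k + 1 : ℕ) : ℤ) - 1) = (k : ℤ) := by push_cast; ring
    rw [h1, intBinom_natCast, intBinom_natCast, intBinom_natCast, ← Int.cast_add]
    have := Ring.choose_succ_succ (c - 1) k
    rw [sub_add_cancel] at this
    rw [this, add_comm]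

theorem intBinom_frobenius {p e : ℕ} (hp : p.Prime) [CharP F p] (c d : ℤ) :
    intBinom F c d =
      intBinom F (c - (p ^ e : ℕ)) d + intBinom F (c - (p ^ e : ℕ)) (d - (p ^ e : ℕ)) := by
  have hq : 0 < p ^ e := pow_pos hp.pos e
  generalize hqq : p ^ e = q at *
  rcases lt_or_ge d 0 with h | h
  · rw [intBinom_neg _ h, intBinom_neg _ h, intBinom_neg _ (by lia), add_zero]
  obtain ⟨k, rfl⟩ : ∃ k : ℕ, d = (k : ℤ) := ⟨d.toNat, by lia⟩
  have key := Ring.add_choose_eq k (Commute.all (c - q : ℤ) (q : ℤ))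
  rw [sub_add_cancel] at key
  have hz : ∀ i, i ≠ 0 → i ≠ q → ((Ring.choose (q : ℤ) i : ℤ) : F) = 0 := by
    intro i h0 h1
    rw [Ring.choose_natCast]
    have : p ∣ q.choose i := by
      rw [← hqq] at h1 ⊢
      exact hp.dvd_choose_pow h0 h1
    rw [Int.cast_natCast]
    exact (CharP.cast_eq_zero_iff F p _).2 this
  rw [intBinom_natCast, intBinom_natCast, key, Finset.Nat.sum_antidiagonal_eq_sum_range_succ_mk,
    Int.cast_sum]
  by_cases hk : k < q
  · rw [intBinom_neg _ (by lia), add_zero, Finset.sum_eq_single k]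
    · simp
    · intro i hi hik
      have := Finset.mem_range.1 hi
      rw [Int.cast_mul, hz (k - i) (by lia) (by lia), mul_zero]
    · simp
  · obtain ⟨m, rfl⟩ : ∃ m, k = m + q := ⟨k - q, by lia⟩
    have hm : (((m + q : ℕ) : ℤ) - q) = (m : ℤ) := by push_cast; ring
    rw [hm, intBinom_natCast, Finset.sum_eq_add (m + q) m (by lia)]
    · simp [Ring.choose_natCast]
    · intro i hi hik
      have := Finset.mem_range.1 hi
      rw [Int.cast_mul, hz (m + q - i) (by lia) (by lia), mul_zero]
    · simp
    · intro h; exact absurd (Finset.mem_range.2 (by lia)) h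

theorem intBinom_base {p e : ℕ} (he : e ≠ 0) [CharP F p] (a : ℤ) (ha : a ≠ 0) :
    intBinom F (((p ^ e : ℕ) - 1) * (-a) - 1) a = 0 := by
  rcases lt_or_ge a 0 with h | h
  · exact intBinom_neg _ h
  obtain ⟨k, rfl⟩ : ∃ k : ℕ, a = ((k + 1 : ℕ) : ℤ) := ⟨(a - 1).toNat, by lia⟩
  have hd : (p : ℤ) ∣ (p ^ e : ℕ) := by exact_mod_cast dvd_pow_self p he
  generalize p ^ e = q at *
  rw [intBinom_natCast]
  have h1 : ((q : ℤ) - 1) * (-((k + 1 : ℕ) : ℤ)) - 1 = -(((q : ℤ) - 1) * ((k + 1 : ℕ) : ℤ) + 1) := by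
    ring
  rw [h1, Ring.choose_neg]
  have h2 : ((q : ℤ) - 1) * ((k + 1 : ℕ) : ℤ) + 1 + ((k + 1 : ℕ) : ℤ) - 1
      = ((q * (k + 1) : ℕ) : ℤ) := by push_cast; ring
  rw [h2, Ring.choose_natCast]
  have h3 : ((q * (k + 1)).choose (k + 1) : F) = 0 := by
    rcases Nat.eq_zero_or_pos q with rfl | hq
    · simp
    have h4 : (q * (k + 1)).choose (k + 1) = q * (q * (k + 1) - 1).choose k := by
      obtain ⟨n, hn⟩ : ∃ n, q * (k + 1) = n + 1 := ⟨q * (k + 1) - 1, by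
        have := Nat.mul_pos hq k.succ_pos; lia⟩
      rw [hn, Nat.add_sub_cancel]
      have := Nat.add_one_mul_choose_eq n k
      rw [← hn] at this
      have h5 : (q * n.choose k) * (k + 1) = (n + 1).choose (k + 1) * (k + 1) := by
        rw [← hn, ← this]; ring
      exact (Nat.eq_of_mul_eq_mul_right k.succ_pos h5).symm
    rw [h4, Nat.cast_mul]
    have : (q : F) = 0 := (CharP.cast_eq_zero_iff F p q).2 (by exact_mod_cast hd)
    rw [this, zero_mul]
  simp [Units.smul_def, h3]

theorem intBinom_adem_aux {p e : ℕ} (hp : p.Prime) (he : e ≠ 0) [CharP F p] (n : ℕ) :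
    ∀ a : ℤ, ∑ j ∈ Finset.range (n + 1), (-1 : F) ^ (a + j) *
      intBinom F (((p ^ e : ℕ) - 1) * (n - a - j) - 1) (a - (p ^ e : ℕ) * j) * (n.choose j : F)
      = intBinom F n a := by
  induction n with
  | zero =>
    intro a
    by_cases ha : a = 0
    · subst ha; simp [intBinom]
    · have h0 : intBinom F ((0 : ℕ) : ℤ) a = 0 := by
        rcases lt_or_ge a 0 with h | h
        · exact intBinom_neg _ h
        · obtain ⟨k, rfl⟩ : ∃ k : ℕ, a = (k : ℤ) := ⟨a.toNat, by lia⟩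
          rw [intBinom_nat, Nat.choose_eq_zero_of_lt (by lia), Nat.cast_zero]
      have := intBinom_base (F := F) he a ha
      rw [h0]
      simp only [zero_add, Finset.range_one, Finset.sum_singleton, Nat.cast_zero, sub_zero,
        mul_zero, zero_sub, this, zero_mul]
  | succ n ih =>
    intro a
    have i1 := ih (a - 1)
    have i2 := ih a
    have hp1 : intBinom F ((n + 1 : ℕ) : ℤ) a = intBinom F n a + intBinom F n (a - 1) := by
      rw [intBinom_pascal]; push_cast; simp
    rw [hp1, ← i1, ← i2]
    generalize hq : p ^ e = q
    have hne : (-1 : F) ≠ 0 := by simp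
    set D : ℕ → F := fun j => (-1 : F) ^ (a + j) *
      intBinom F (((q : ℤ) - 1) * (n + 1 - a - j) - 1) (a - q * j) with hD
    -- split the binomial coefficient
    have s1 : ∑ j ∈ Finset.range (n + 1 + 1), D j * ((n + 1).choose j : F)
        = ∑ j ∈ Finset.range (n + 1), (D j + D (j + 1)) * (n.choose j : F) := by
      rw [Finset.sum_range_succ' _ (n + 1)]
      simp only [Nat.choose_succ_succ, Nat.cast_add, mul_add, add_mul, Finset.sum_add_distrib]
      have : ∑ j ∈ Finset.range (n + 1), D j * (n.choose j : F)
          = ∑ j ∈ Finset.range (n + 1), D (j + 1) * (n.choose (j + 1) : F)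
            + D 0 * ((n + 1).choose 0 : F) := by
        have h := Finset.sum_range_succ' (fun j => D j * (n.choose j : F)) (n + 1)
        rw [Finset.sum_range_succ] at h
        simp only [Nat.choose_succ_self, Nat.cast_zero, mul_zero, add_zero] at h
        rw [h]; simp
      rw [this]; ring
    have lhs : ∑ j ∈ Finset.range (n + 1 + 1), (-1 : F) ^ (a + j) *
        intBinom F (((q : ℤ) - 1) * ((n + 1 : ℕ) - a - j) - 1) (a - q * j) *
          ((n + 1).choose j : F) = ∑ j ∈ Finset.range (n + 1 + 1), D j * ((n + 1).choose j : F) := by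
      simp only [hD]; push_cast; rfl
    rw [lhs, s1, ← Finset.sum_add_distrib]
    refine Finset.sum_congr rfl fun j _ => ?_
    rw [← add_mul]
    congr 1
    simp only [hD]
    set c : ℤ := ((q : ℤ) - 1) * (n + 1 - a - j) with hc
    have f1 := intBinom_pascal (F := F) c (a - q * j)
    have f2 := intBinom_frobenius (F := F) (e := e) hp c (a - q * j)
    rw [hq] at f2
    have e1 : ((q : ℤ) - 1) * (n + 1 - a - ((j + 1 : ℕ) : ℤ)) - 1 = c - q := by
      rw [hc]; push_cast; ring
    have e2 : (a - q * ((j + 1 : ℕ) : ℤ)) = a - q * j - q := by push_cast; ring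
    have e3 : ((q : ℤ) - 1) * (n - a - j) - 1 = c - q := by rw [hc]; ring
    have e4 : ((q : ℤ) - 1) * (n - (a - 1) - j) - 1 = c - 1 := by rw [hc]; ring
    have e5 : a - 1 - q * (j : ℤ) = a - q * j - 1 := by ring
    have g1 : (-1 : F) ^ (a + ((j + 1 : ℕ) : ℤ)) = - (-1 : F) ^ (a + j) := by
      rw [show a + ((j + 1 : ℕ) : ℤ) = (a + j) + 1 by push_cast; ring, zpow_add_one₀ hne]; ring
    have g2 : (-1 : F) ^ (a - 1 + (j : ℤ)) = - (-1 : F) ^ (a + j) := by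
      rw [show a + (j : ℤ) = (a - 1 + j) + 1 by ring, zpow_add_one₀ hne]; ring
    rw [e1, e2, e3, e4, e5, g1, g2]
    linear_combination (-1 : F) ^ (a + (j : ℤ)) * (f2 - f1)

/-- The identity between binomial coefficients behind the Adem relations. -/
theorem adem_binomial {p e : ℕ} (hp : p.Prime) (he : e ≠ 0) [CharP F p] (a b : ℕ)
    (hab : a < p ^ e * b) :
    ∑ j ∈ Finset.range (a / p ^ e + 1), (-1 : F) ^ (a + j) *
      (((p ^ e - 1) * (b - j) - 1).choose (a - p ^ e * j) : F) * ((a + b).choose j : F)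
      = ((a + b).choose a : F) := by
  have h := intBinom_adem_aux (F := F) hp he (a + b) a
  rw [intBinom_nat] at h
  rw [← h]
  have hq : 1 < p ^ e := Nat.one_lt_pow he hp.one_lt
  generalize p ^ e = q at *
  have hlt : a / q < b := Nat.div_lt_of_lt_mul hab
  rw [← Finset.sum_subset (Finset.range_mono (show a / q + 1 ≤ a + b + 1 by lia))]
  · refine Finset.sum_congr rfl fun j hj => ?_
    have hj' : j ≤ a / q := by have := Finset.mem_range.1 hj; lia
    have hjq : q * j ≤ a := by
      rw [mul_comm]; exact (Nat.le_div_iff_mul_le (by lia)).1 hj'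
    have hpos : 1 ≤ (q - 1) * (b - j) := Nat.mul_pos (by lia) (by lia)
    have e1 : ((q : ℤ) - 1) * (((a + b : ℕ) : ℤ) - a - j) - 1
        = (((q - 1) * (b - j) - 1 : ℕ) : ℤ) := by
      rw [Nat.cast_sub hpos, Nat.cast_mul, Nat.cast_sub hq.le, Nat.cast_sub (by lia)]
      push_cast; ring
    have e2 : (a : ℤ) - q * j = ((a - q * j : ℕ) : ℤ) := by
      rw [Nat.cast_sub hjq]; push_cast; ring
    rw [e1, e2, intBinom_nat]
    norm_cast
  · intro j _ hj
    have hj' : a / q < j := by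
      by_contra hcon
      exact hj (Finset.mem_range.2 (by lia))
    have : a < q * j := by
      rw [mul_comm]; exact (Nat.div_lt_iff_lt_mul (by lia)).1 hj'
    rw [intBinom_neg _ (by zify at this; lia)]
    simp
end

section
variable (F : Type*) [Field F]

theorem milnorOp_apply (q : ℕ) {ℓ : ℕ} (R : Fin ℓ → ℕ) (f : MvPolynomial ℕ F) :
    milnorOp F q R f =
      (milnorTotal F q ℓ f).coeff (Finsupp.equivFunOnFinite.symm R) := rfl

theorem milnorTotal_X (q ℓ j : ℕ) : milnorTotal F q ℓ (MvPolynomial.X j) =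
    MvPolynomial.C (MvPolynomial.X j) +
      ∑ i : Fin ℓ, MvPolynomial.X i * MvPolynomial.C (MvPolynomial.X j ^ q ^ (i.val + 1)) :=
  MvPolynomial.aeval_X _ _

theorem symm_fin_one (a : ℕ) :
    (Finsupp.equivFunOnFinite.symm ![a] : Fin 1 →₀ ℕ) = Finsupp.single 0 a := by
  ext; simp

theorem symm_fin_two (a b : ℕ) :
    (Finsupp.equivFunOnFinite.symm ![a, b] : Fin 2 →₀ ℕ)
      = Finsupp.single 0 a + Finsupp.single 1 b := by
  ext i; fin_cases i <;> simp

theorem fin_two_inj (a b c d : ℕ) :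
    (Finsupp.single 0 a + Finsupp.single 1 b : Fin 2 →₀ ℕ)
      = Finsupp.single 0 c + Finsupp.single 1 d ↔ a = c ∧ b = d := by
  constructor
  · intro h
    have h0 := DFunLike.congr_fun h 0
    have h1 := DFunLike.congr_fun h 1
    simpa using And.intro h0 h1
  · rintro ⟨rfl, rfl⟩; rfl

theorem monomial_fin_two {S : Type*} [CommRing S] (u v : ℕ) (c : S) :
    (MvPolynomial.monomial (Finsupp.single 0 u + Finsupp.single 1 v) c : MvPolynomial (Fin 2) S)
      = MvPolynomial.C c * MvPolynomial.X 0 ^ u * MvPolynomial.X 1 ^ v := by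
  simp only [MvPolynomial.X_pow_eq_monomial, MvPolynomial.C_mul_monomial,
    MvPolynomial.monomial_mul, mul_one]

theorem rename_monomial_fin_one {S : Type*} [CommRing S] (n m : ℕ) (c : S) :
    MvPolynomial.rename (fun _ => (0 : Fin 2))
        (MvPolynomial.monomial (Finsupp.single (0 : Fin 1) n) c) * MvPolynomial.X 1 ^ m
      = MvPolynomial.monomial (Finsupp.single 0 n + Finsupp.single 1 m) c := by
  simp only [MvPolynomial.rename_monomial, Finsupp.mapDomain_single,
    MvPolynomial.X_pow_eq_monomial, MvPolynomial.monomial_mul, mul_one]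

theorem rename_milnorTotal_X (q j : ℕ) :
    MvPolynomial.rename (fun _ => (0 : Fin 2)) (milnorTotal F q 1 (MvPolynomial.X j)) =
      MvPolynomial.C (MvPolynomial.X j) +
        MvPolynomial.X 0 * MvPolynomial.C (MvPolynomial.X j ^ q) := by
  rw [milnorTotal_X]; simp

theorem milnorOp_zero (q : ℕ) {ℓ : ℕ} : milnorOp F q (0 : Fin ℓ → ℕ) = 1 := by
  let ev : MvPolynomial (Fin ℓ) (MvPolynomial ℕ F) →ₐ[F] MvPolynomial ℕ F :=
    (MvPolynomial.aeval (fun _ => 0)).restrictScalars F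
  have h : ev.comp (milnorTotal F q ℓ) = AlgHom.id F _ := by
    ext j
    simp [ev, milnorTotal]
  have h2 : ∀ g : MvPolynomial (Fin ℓ) (MvPolynomial ℕ F), ev g = g.coeff 0 := by
    intro g
    simp [ev, MvPolynomial.constantCoeff_eq]
  refine LinearMap.ext fun f => ?_
  have := DFunLike.congr_fun h f
  rw [AlgHom.comp_apply, h2] at this
  have h0 : (Finsupp.equivFunOnFinite.symm (0 : Fin ℓ → ℕ)) = 0 := by ext; simp
  rw [milnorOp_apply, h0]
  exact this

/-- Composite of two Steenrod powers in terms of Milnor operations. -/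
theorem steenrodOp_mul {p e : ℕ} (hp : p.Prime) [CharP F p] (a b : ℕ) :
    steenrodOp F (p ^ e) a * steenrodOp F (p ^ e) b =
      ∑ k ∈ Finset.range (b + 1), if p ^ e * k ≤ a then
        ((a + b - (p ^ e + 1) * k).choose (b - k) : F) •
          milnorOp F (p ^ e) ![a + b - (p ^ e + 1) * k, k] else 0 := by
  have : Fact p.Prime := ⟨hp⟩
  have hq0 : 0 < p ^ e := pow_pos hp.pos e
  let S := MvPolynomial ℕ F
  let B := MvPolynomial (Fin 2) S
  let s : B := MvPolynomial.X 0
  let t : B := MvPolynomial.X 1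
  have : CharP B p := inferInstance
  -- total power in the variable s
  let r0 : MvPolynomial (Fin 1) S →ₐ[S] B := MvPolynomial.rename (fun _ => (0 : Fin 2))
  let Ts : S →ₐ[F] B := (r0.restrictScalars F).comp (milnorTotal F (p ^ e) 1)
  let T' : MvPolynomial (Fin 1) S →+* B := MvPolynomial.eval₂Hom Ts.toRingHom (fun _ => t)
  let G : MvPolynomial (Fin 2) S →ₐ[S] B :=
    MvPolynomial.aeval ![s + t, t * s ^ (p ^ e)]
  have hTs : ∀ j : ℕ, Ts (MvPolynomial.X j) =
      MvPolynomial.C (MvPolynomial.X j) + s * MvPolynomial.C (MvPolynomial.X j ^ p ^ e) := by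
    intro j
    exact rename_milnorTotal_X F (p ^ e) j
  have hcomp : T'.comp (milnorTotal F (p ^ e) 1).toRingHom
      = (G : MvPolynomial (Fin 2) S →+* B).comp (milnorTotal F (p ^ e) 2).toRingHom := by
    apply MvPolynomial.ringHom_ext
    · intro c
      have h1 : (milnorTotal F (p ^ e) 1).toRingHom (MvPolynomial.C c)
          = MvPolynomial.C (MvPolynomial.C c) :=
        (milnorTotal F (p ^ e) 1).commutes c
      have h2 : (milnorTotal F (p ^ e) 2).toRingHom (MvPolynomial.C c)
          = MvPolynomial.C (MvPolynomial.C c) :=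
        (milnorTotal F (p ^ e) 2).commutes c
      rw [RingHom.comp_apply, RingHom.comp_apply, h1, h2]
      simp only [T', MvPolynomial.coe_eval₂Hom, MvPolynomial.eval₂_C]
      have h3 : Ts.toRingHom (MvPolynomial.C c) = MvPolynomial.C (MvPolynomial.C c) :=
        Ts.commutes c
      rw [h3]
      exact (G.commutes _).symm
    · intro j
      have h1 : (milnorTotal F (p ^ e) 1).toRingHom (MvPolynomial.X j)
          = MvPolynomial.C (MvPolynomial.X j) +
            MvPolynomial.X 0 * MvPolynomial.C (MvPolynomial.X j ^ p ^ e) := by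
        simp [milnorTotal_X]
      have h2 : (milnorTotal F (p ^ e) 2).toRingHom (MvPolynomial.X j)
          = MvPolynomial.C (MvPolynomial.X j) +
            (MvPolynomial.X 0 * MvPolynomial.C (MvPolynomial.X j ^ p ^ e)
             + MvPolynomial.X 1 * MvPolynomial.C (MvPolynomial.X j ^ (p ^ e) ^ 2)) := by
        simp [milnorTotal_X, Fin.sum_univ_two]
      rw [RingHom.comp_apply, RingHom.comp_apply, h1, h2]
      have h3 : ∀ x : S, T' (MvPolynomial.C x) = Ts x := fun x => by
        simp [T']
      have h4 : ∀ x : S, (G : MvPolynomial (Fin 2) S →+* B) (MvPolynomial.C x)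
          = MvPolynomial.C x := fun x => G.commutes x
      have h5 : T' (MvPolynomial.X 0) = t := by simp [T']
      have h6 : (G : MvPolynomial (Fin 2) S →+* B) (MvPolynomial.X 0) = s + t := by simp [G]
      have h7 : (G : MvPolynomial (Fin 2) S →+* B) (MvPolynomial.X 1) = t * s ^ (p ^ e) := by
        simp [G]
      simp only [map_add, map_mul, h3, h4, h5, h6, h7, map_pow, hTs]
      rw [add_pow_char_pow]
      ring
  -- coefficient extraction on the two sides
  have hL : ∀ g : MvPolynomial (Fin 1) S,
      (T' g).coeff (Finsupp.equivFunOnFinite.symm ![a, b])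
        = steenrodOp F (p ^ e) a (g.coeff (Finsupp.equivFunOnFinite.symm ![b])) := by
    have hmon : ∀ (m : ℕ) (h : MvPolynomial (Fin 1) S),
        (r0 h * t ^ m).coeff (Finsupp.single 0 a + Finsupp.single 1 b)
          = if m = b then h.coeff (Finsupp.single 0 a) else 0 := by
      intro m h
      induction h using MvPolynomial.induction_on' with
      | monomial n c =>
        obtain ⟨n, rfl⟩ : ∃ n', n = Finsupp.single 0 n' := ⟨n 0, Finsupp.unique_single n⟩
        have : r0 (MvPolynomial.monomial (Finsupp.single 0 n) c) * t ^ m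
            = MvPolynomial.monomial (Finsupp.single 0 n + Finsupp.single 1 m) c :=
          rename_monomial_fin_one n m c
        rw [this, MvPolynomial.coeff_monomial, MvPolynomial.coeff_monomial]
        simp only [fin_two_inj, (Finsupp.single_injective (0 : Fin 1)).eq_iff]
        split_ifs <;> first | rfl | (exfalso; lia)
      | add x y hx hy =>
        rw [map_add, add_mul, MvPolynomial.coeff_add, hx, hy, MvPolynomial.coeff_add]
        split_ifs <;> simp
    intro g
    rw [symm_fin_two, symm_fin_one]
    induction g using MvPolynomial.induction_on' with
    | monomial n c =>
      obtain ⟨n, rfl⟩ : ∃ n', n = Finsupp.single 0 n' := ⟨n 0, Finsupp.unique_single n⟩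
      have : T' (MvPolynomial.monomial (Finsupp.single 0 n) c)
          = r0 (milnorTotal F (p ^ e) 1 c) * t ^ n := by
        simp only [T', MvPolynomial.coe_eval₂Hom, MvPolynomial.eval₂_monomial]
        exact congrArg (Ts c * ·) (Finsupp.prod_single_index (pow_zero t))
      rw [this, hmon, MvPolynomial.coeff_monomial]
      simp only [(Finsupp.single_injective (0 : Fin 1)).eq_iff]
      split_ifs
      · rw [steenrodOp, milnorOp_apply, symm_fin_one]
      · simp
    | add x y hx hy =>
      rw [map_add, MvPolynomial.coeff_add, hx, hy, MvPolynomial.coeff_add, map_add]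
  have hR : ∀ g : MvPolynomial (Fin 2) S,
      (G g).coeff (Finsupp.equivFunOnFinite.symm ![a, b])
        = ∑ k ∈ Finset.range (b + 1), if p ^ e * k ≤ a then
          ((a + b - (p ^ e + 1) * k).choose (b - k) : F) •
            g.coeff (Finsupp.equivFunOnFinite.symm ![a + b - (p ^ e + 1) * k, k]) else 0 := by
    intro g
    simp only [symm_fin_two]
    induction g using MvPolynomial.induction_on' with
    | monomial n c =>
      obtain ⟨u, v, rfl⟩ : ∃ u v, n = Finsupp.single 0 u + Finsupp.single 1 v :=
        ⟨n 0, n 1, by ext i; fin_cases i <;> simp⟩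
      have hG : G (MvPolynomial.monomial (Finsupp.single 0 u + Finsupp.single 1 v) c)
          = ∑ m ∈ Finset.range (u + 1), MvPolynomial.monomial
            (Finsupp.single 0 (m + p ^ e * v) + Finsupp.single 1 (u - m + v))
              (c * (u.choose m : S)) := by
        have h1 : (MvPolynomial.monomial (Finsupp.single 0 u + Finsupp.single 1 v) c
            : MvPolynomial (Fin 2) S) = MvPolynomial.C c * MvPolynomial.X 0 ^ u *
              MvPolynomial.X 1 ^ v := monomial_fin_two u v c
        have h2 : G (MvPolynomial.C c) = MvPolynomial.C c := G.commutes c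
        have h6 : G (MvPolynomial.X 0) = s + t := by simp [G]
        have h7 : G (MvPolynomial.X 1) = t * s ^ (p ^ e) := by simp [G]
        rw [h1, map_mul, map_mul, map_pow, map_pow, h2, h6, h7, add_pow, Finset.mul_sum,
          Finset.sum_mul]
        refine Finset.sum_congr rfl fun m _ => ?_
        have h8 : (MvPolynomial.monomial
            (Finsupp.single 0 (m + p ^ e * v) + Finsupp.single 1 (u - m + v))
              (c * (u.choose m : S)) : B) = MvPolynomial.C c * (u.choose m : B) *
              s ^ (m + p ^ e * v) * t ^ (u - m + v) := by
          rw [← map_natCast (MvPolynomial.C : S →+* B), ← MvPolynomial.C_mul]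
          exact monomial_fin_two _ _ _
        rw [h8]
        ring
      rw [hG, MvPolynomial.coeff_sum]
      simp only [MvPolynomial.coeff_monomial, fin_two_inj]
      by_cases hc : p ^ e * v ≤ a ∧ v ≤ b ∧ u + (p ^ e + 1) * v = a + b
      · obtain ⟨ha, hb, hu⟩ := hc
        rw [add_mul, one_mul] at hu
        rw [Finset.sum_eq_single (a - p ^ e * v), Finset.sum_eq_single v]
        · have e1 : a + b - (p ^ e + 1) * v = u := by rw [add_mul, one_mul]; lia
          have e2 : u.choose (a - p ^ e * v) = u.choose (b - v) :=
            Nat.choose_symm_of_eq_add (by lia)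
          rw [if_pos (by lia), if_pos ha, e1, if_pos ⟨rfl, rfl⟩, e2, mul_comm,
            ← nsmul_eq_mul, Nat.cast_smul_eq_nsmul]
        · intro k _ hk
          simp [hk.symm]
        · intro h; exact absurd (Finset.mem_range.2 (by lia)) h
        · intro m _ hm
          rw [if_neg (by lia)]
        · intro h; exact absurd (Finset.mem_range.2 (by lia)) h
      · rw [Finset.sum_eq_zero, Finset.sum_eq_zero]
        · intro k hk
          have hk' := Finset.mem_range.1 hk
          split_ifs with h1 h2
          · exfalso
            obtain ⟨h2, rfl⟩ := h2
            apply hc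
            refine ⟨h1, by lia, ?_⟩
            rw [h2]
            have : (p ^ e + 1) * v = p ^ e * v + v := by ring
            lia
          · simp
          · rfl
        · intro m hm
          have hm' := Finset.mem_range.1 hm
          rw [if_neg]
          rintro ⟨h1, h2⟩
          apply hc
          have : (p ^ e + 1) * v = p ^ e * v + v := by ring
          refine ⟨by lia, by lia, by lia⟩
    | add x y hx hy =>
      rw [map_add, MvPolynomial.coeff_add, hx, hy, ← Finset.sum_add_distrib]
      refine Finset.sum_congr rfl fun k _ => ?_
      rw [MvPolynomial.coeff_add]
      split_ifs <;> simp
  refine LinearMap.ext fun f => ?_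
  have key := congrArg (fun h => MvPolynomial.coeff (Finsupp.equivFunOnFinite.symm ![a, b]) h)
    (DFunLike.congr_fun hcomp f)
  simp only [RingHom.comp_apply] at key
  have key2 := (hL _).symm.trans (key.trans (hR _))
  rw [Module.End.mul_apply, LinearMap.sum_apply]
  refine key2.trans (Finset.sum_congr rfl fun k _ => ?_)
  split_ifs
  · rfl
  · rfl
end

section
open MvPolynomial
/-- The sequence `R_e`, with term `r_k` in position `k e` and `0` in the positions that `e` does not
divide. -/
def spread (e : ℕ) {ℓ : ℕ} (R : Fin ℓ → ℕ) : Fin (ℓ * e) → ℕ :=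
  fun j => ∑ i : Fin ℓ, if (i.val + 1) * e = j.val + 1 then R i else 0

theorem coeff_killCompl' {σ τ S : Type*} [CommRing S] {f : σ → τ} (hf : f.Injective)
    (g : MvPolynomial τ S) (m : σ →₀ ℕ) :
    (killCompl hf g).coeff m = g.coeff (m.mapDomain f) := by
  classical
  induction g using MvPolynomial.induction_on' with
  | monomial s c =>
    by_cases hs : (s.support : Set τ) ⊆ Set.range f
    · obtain ⟨u, rfl⟩ : ∃ u : σ →₀ ℕ, s = u.mapDomain f :=
        ⟨s.comapDomain f hf.injOn, (Finsupp.mapDomain_comapDomain f hf s hs).symm⟩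
      rw [killCompl_monomial_mapDomain, coeff_monomial, coeff_monomial]
      simp only [(Finsupp.mapDomain_injective hf).eq_iff]
    · rw [killCompl_monomial_eq_zero_of_not_subset hf c hs, coeff_zero, coeff_monomial, if_neg]
      rintro rfl
      apply hs
      intro x hx
      have := Finsupp.mapDomain_support hx
      obtain ⟨y, _, rfl⟩ := Finset.mem_image.1 this
      exact ⟨y, rfl⟩
  | add x y hx hy => rw [map_add, coeff_add, coeff_add, hx, hy]

/-- The operation `P(R)` formed with `q ^ e` is the operation `P(R_e)` formed with `q`.  For a prime
`q = p` the latter are the Milnor basis elements of the algebra of Steenrod `p`-th powers. -/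
theorem milnorOp_pow (F : Type*) [Field F] (q e : ℕ) (he : 1 ≤ e) {ℓ : ℕ} (R : Fin ℓ → ℕ) :
    milnorOp F (q ^ e) R = milnorOp F q (spread e R) := by
  let f : Fin ℓ → Fin (ℓ * e) := fun i => ⟨(i.val + 1) * e - 1, by
    have h1 : (i.val + 1) * e ≤ ℓ * e := Nat.mul_le_mul_right e i.isLt
    have h2 : 0 < (i.val + 1) * e := Nat.mul_pos i.val.succ_pos he
    exact lt_of_lt_of_le (Nat.sub_lt h2 one_pos) h1⟩
  have hfv : ∀ i, (f i).val + 1 = (i.val + 1) * e := fun i => by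
    have h2 : 0 < (i.val + 1) * e := Nat.mul_pos i.val.succ_pos he
    exact Nat.sub_add_cancel h2
  have hf : f.Injective := fun i j h => by
    have := (hfv i).symm.trans ((congrArg (fun x => x.val + 1) h).trans (hfv j))
    have := Nat.eq_of_mul_eq_mul_right he this
    exact Fin.ext (by lia)
  have hcomp : ((killCompl hf).restrictScalars F).comp (milnorTotal F q (ℓ * e))
      = milnorTotal F (q ^ e) ℓ := by
    apply MvPolynomial.algHom_ext
    intro j
    have hC : ∀ x : MvPolynomial ℕ F, killCompl hf (C x) = C x := fun x => (killCompl hf).commutes x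
    rw [AlgHom.comp_apply, milnorTotal_X, milnorTotal_X]
    simp only [AlgHom.restrictScalars_apply, map_add, map_sum, map_mul, hC]
    congr 1
    rw [← Finset.sum_subset (Finset.subset_univ (Finset.univ.map ⟨f, hf⟩)), Finset.sum_map]
    · refine Finset.sum_congr rfl fun i _ => ?_
      have h1 : killCompl hf (X (f i)) = (X i : MvPolynomial (Fin ℓ) (MvPolynomial ℕ F)) := by
        rw [← rename_X f i, killCompl_rename_app]
      simp only [Function.Embedding.coeFn_mk]
      rw [h1, hfv, ← pow_mul, mul_comm e]
    · intro k _ hk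
      have hk' : k ∉ Set.range f := by
        rintro ⟨i, rfl⟩
        exact hk (Finset.mem_map_of_mem ⟨f, hf⟩ (Finset.mem_univ i))
      have h1 : killCompl hf (X k) = (0 : MvPolynomial (Fin ℓ) (MvPolynomial ℕ F)) := by
        rw [killCompl, aeval_X, dif_neg hk']
      rw [h1, zero_mul]
  refine LinearMap.ext fun g => ?_
  rw [milnorOp_apply, milnorOp_apply, ← hcomp, AlgHom.comp_apply, AlgHom.restrictScalars_apply,
    coeff_killCompl']
  congr 1
  ext j
  simp only [Finsupp.equivFunOnFinite_symm_apply_apply, spread, Finsupp.mapDomain, Finsupp.sum_fintype,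
    Finsupp.single_zero, implies_true, Finsupp.coe_finsetSum, Finset.sum_apply, Finsupp.single_apply]
  refine Finset.sum_congr rfl fun i _ => ?_
  have : f i = j ↔ (i.val + 1) * e = j.val + 1 := by
    rw [← hfv i, Fin.ext_iff]; lia
  simp [this]
end

theorem steenrodOp_zero (F : Type*) [Field F] (q : ℕ) : steenrodOp F q 0 = 1 := by
  have h : (![0] : Fin 1 → ℕ) = 0 := by ext; simp
  rw [steenrodOp, h, milnorOp_zero]

/-- The Steenrod powers on polynomials satisfy the Adem relations. -/
theorem steenrodOp_adem (F : Type*) [Field F] {p e : ℕ} (hp : p.Prime) (he : e ≠ 0) [CharP F p]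
    (a b : ℕ) (hab : a < p ^ e * b) :
    steenrodOp F (p ^ e) a * steenrodOp F (p ^ e) b =
      ∑ j ∈ Finset.range (a / p ^ e + 1),
        ((-1 : F) ^ (a + j) * (((p ^ e - 1) * (b - j) - 1).choose (a - p ^ e * j) : F)) •
          (steenrodOp F (p ^ e) (a + b - j) * steenrodOp F (p ^ e) j) := by
  have hq : 1 < p ^ e := Nat.one_lt_pow he hp.one_lt
  have hsign : (-1 : F) ^ (p ^ e + 1) = 1 := by
    rcases hp.eq_two_or_odd' with rfl | h
    · have : (-1 : F) = 1 := by
        have h2 : (2 : F) = 0 := by exact_mod_cast CharP.cast_eq_zero F 2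
        linear_combination -h2
      rw [this, one_pow]
    · exact ((h.pow (n := e)).add_one).neg_one_pow
  have hlt : a / p ^ e < b := Nat.div_lt_of_lt_mul hab
  simp only [steenrodOp_mul F hp]
  generalize hqq : p ^ e = q at *
  have hj : ∀ j ∈ Finset.range (a / q + 1), q * j ≤ a ∧ j ≤ a / q := by
    intro j hj
    have hj' : j ≤ a / q := by have := Finset.mem_range.1 hj; lia
    refine ⟨?_, hj'⟩
    rw [mul_comm]; exact (Nat.le_div_iff_mul_le (by lia)).1 hj'
  -- the right-hand side, with summation indices independent of each other
  have hR : ∀ j ∈ Finset.range (a / q + 1),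
      (∑ k ∈ Finset.range (j + 1), if q * k ≤ a + b - j then
        ((a + b - j + j - (q + 1) * k).choose (j - k) : F) •
          milnorOp F q ![a + b - j + j - (q + 1) * k, k] else 0)
      = ∑ k ∈ Finset.range (a / q + 1), if k ≤ j then
        ((a + b - (q + 1) * k).choose (j - k) : F) •
          milnorOp F q ![a + b - (q + 1) * k, k] else 0 := by
    intro j hj'
    obtain ⟨h1, h2⟩ := hj j hj'
    have h3 : a + b - j + j = a + b := by
      have : j ≤ a := le_trans h2 (Nat.div_le_self _ _)
      lia
    rw [h3]
    rw [← Finset.sum_subset (Finset.range_mono (show j + 1 ≤ a / q + 1 by lia))]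
    · refine Finset.sum_congr rfl fun k hk => ?_
      have hk' : k ≤ j := by have := Finset.mem_range.1 hk; lia
      have : q * k ≤ q * j := Nat.mul_le_mul_left q hk'
      rw [if_pos (by lia), if_pos hk']
    · intro k _ hk
      rw [if_neg]
      intro hkj
      exact hk (Finset.mem_range.2 (by lia))
  refine Eq.trans ?_ (Finset.sum_congr rfl fun j hj' => congrArg (fun x => ((-1 : F) ^ (a + j) *
    (((q - 1) * (b - j) - 1).choose (a - q * j) : F)) • x) (hR j hj')).symm
  simp only [Finset.smul_sum]
  rw [Finset.sum_comm]
  -- the left-hand side over the same range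
  rw [← Finset.sum_subset (Finset.range_mono (show a / q + 1 ≤ b + 1 by lia))]
  · refine Finset.sum_congr rfl fun k hk => ?_
    obtain ⟨h1, h2⟩ := hj k hk
    rw [if_pos h1]
    have e0 : (q + 1) * k = q * k + k := by ring
    have hid := adem_binomial (F := F) hp he (a - q * k) (b - k) (by
      rw [hqq, Nat.mul_sub]
      have : q * k < q * b := Nat.mul_lt_mul_of_pos_left (by lia) (by lia)
      lia)
    rw [hqq] at hid
    have e1 : a - q * k + (b - k) = a + b - (q + 1) * k := by lia
    have e2 : (a - q * k) / q = a / q - k := by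
      rw [Nat.sub_mul_div]
    have e3 : (a + b - (q + 1) * k).choose (a - q * k)
        = (a + b - (q + 1) * k).choose (b - k) := Nat.choose_symm_of_eq_add (by lia)
    rw [e1, e2, e3] at hid
    rw [← hid, Finset.sum_smul]
    have e4 : a / q + 1 = k + (a / q - k + 1) := by lia
    rw [e4, Finset.sum_range_add _ k, Finset.sum_eq_zero (s := Finset.range k), zero_add]
    · refine Finset.sum_congr rfl fun i hi => ?_
      rw [if_pos (by lia), smul_smul]
      have e5 : b - (k + i) = b - k - i := by lia
      have e6 : a - q * (k + i) = a - q * k - q * i := by rw [mul_add]; lia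
      have e7 : k + i - k = i := by lia
      have e8 : (-1 : F) ^ (a + (k + i)) = (-1 : F) ^ (a - q * k + i) := by
        have : a + (k + i) = (a - q * k + i) + (q + 1) * k := by lia
        rw [this, pow_add, pow_mul, hsign, one_pow, mul_one]
      rw [e5, e6, e7, e8]
    · intro i hi
      have := Finset.mem_range.1 hi
      rw [if_neg (by lia), smul_zero]
  · intro k _ hk
    rw [if_neg]
    intro h
    apply hk
    have : k ≤ a / q := (Nat.le_div_iff_mul_le (by lia)).2 (by rw [mul_comm]; exact h)
    exact Finset.mem_range.2 (by lia)

/-- The defining relations of the algebra of Steenrod `q`-th powers on generators `P^r`, `r ≥ 0`: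
`P^0 = 1`, and the Adem relations for `a < q b`.  No natural number subtraction truncates here, as
`q j ≤ a < q b` in the range of summation. -/
inductive AdemRel (F : Type*) [Field F] (q : ℕ) :
    FreeAlgebra F ℕ → FreeAlgebra F ℕ → Prop
  | zero : AdemRel F q (FreeAlgebra.ι F 0) 1
  | adem (a b : ℕ) (h : a < q * b) :
      AdemRel F q (FreeAlgebra.ι F a * FreeAlgebra.ι F b)
        (∑ j ∈ Finset.range (a / q + 1),
          ((-1 : F) ^ (a + j) * (((q - 1) * (b - j) - 1).choose (a - q * j) : F)) •
            (FreeAlgebra.ι F (a + b - j) * FreeAlgebra.ι F j))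

/-- The algebra of Steenrod `q`-th powers over the finite field `F` with `q` elements. -/
abbrev SteenrodAlgebra (F : Type*) [Field F] : Type _ :=
  RingQuot (AdemRel F (Nat.card F))

/-- The generator `P^r`. -/
noncomputable def steenrodPower (F : Type*) [Field F] (r : ℕ) : SteenrodAlgebra F :=
  RingQuot.mkAlgHom F (AdemRel F (Nat.card F)) (FreeAlgebra.ι F r)

theorem augmentation_aux (F : Type*) [Field F] (q : ℕ) ⦃x y : FreeAlgebra F ℕ⦄
    (h : AdemRel F q x y) :
    FreeAlgebra.lift F (fun r : ℕ => if r = 0 then (1 : F) else 0) x =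
      FreeAlgebra.lift F (fun r : ℕ => if r = 0 then (1 : F) else 0) y := by
  cases h with
  | zero => simp
  | adem a b h =>
    have hb : b ≠ 0 := by rintro rfl; simp at h
    have hlt : a / q < b := Nat.div_lt_of_lt_mul h
    simp only [map_mul, map_sum, map_smul, FreeAlgebra.lift_ι_apply, if_neg hb, mul_zero]
    refine (Finset.sum_eq_zero fun j hj => ?_).symm
    have := Finset.mem_range.1 hj
    rw [if_neg (show a + b - j ≠ 0 by lia), zero_mul, smul_zero]

/-- The augmentation: `P^0 ↦ 1` and `P^r ↦ 0` for `r > 0`. -/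
noncomputable def augmentation (F : Type*) [Field F] : SteenrodAlgebra F →ₐ[F] F :=
  RingQuot.liftAlgHom F
    ⟨FreeAlgebra.lift F (fun r : ℕ => if r = 0 then (1 : F) else 0),
      augmentation_aux F (Nat.card F)⟩

theorem augmentation_steenrodPower (F : Type*) [Field F] (r : ℕ) :
    augmentation F (steenrodPower F r) = if r = 0 then 1 else 0 := by
  simp [augmentation, steenrodPower]

theorem steenrodAction_aux (F : Type*) [Field F] [Finite F] ⦃x y : FreeAlgebra F ℕ⦄
    (h : AdemRel F (Nat.card F) x y) :
    FreeAlgebra.lift F (steenrodOp F (Nat.card F)) x =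
      FreeAlgebra.lift F (steenrodOp F (Nat.card F)) y := by
  cases nonempty_fintype F
  obtain ⟨p, hchar⟩ := CharP.exists F
  obtain ⟨e, hp, hcard⟩ := FiniteField.card F p
  rw [← Nat.card_eq_fintype_card] at hcard
  rw [hcard] at h ⊢
  cases h with
  | zero => simp [steenrodOp_zero]
  | adem a b h =>
    simp only [map_mul, map_sum, map_smul, FreeAlgebra.lift_ι_apply]
    exact steenrodOp_adem F hp e.ne_zero a b h

/-- The action of the algebra of Steenrod `q`-th powers on polynomials over `F` in infinitely many
variables, in which the generator `P^r` acts as the Steenrod power `P^r`. -/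
noncomputable def steenrodAction (F : Type*) [Field F] [Finite F] :
    SteenrodAlgebra F →ₐ[F] Module.End F (MvPolynomial ℕ F) :=
  RingQuot.liftAlgHom F
    ⟨FreeAlgebra.lift F (steenrodOp F (Nat.card F)), steenrodAction_aux F⟩

theorem steenrodAction_steenrodPower (F : Type*) [Field F] [Finite F] (r : ℕ) :
    steenrodAction F (steenrodPower F r) = steenrodOp F (Nat.card F) r := by
  simp [steenrodAction, steenrodPower]

/-- `θ` is the Milnor basis element `P(R)`: it acts on polynomials as the Milnor operation `P(R)`. -/
def IsMilnorElement {F : Type*} [Field F] [Finite F] {ℓ : ℕ} (R : Fin ℓ → ℕ)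
    (θ : SteenrodAlgebra F) : Prop :=
  steenrodAction F θ = milnorOp F (Nat.card F) R

/-- The augmentation ideal, the kernel of the augmentation (a two-sided ideal). -/
noncomputable def augmentationIdeal (F : Type*) [Field F] : Ideal (SteenrodAlgebra F) :=
  RingHom.ker (augmentation F)

/-- `θ` has May filtration `m`: it lies in the `m`-th power of the augmentation ideal but not in the
`(m + 1)`-st. -/
def HasMayFiltration {F : Type*} [Field F] (θ : SteenrodAlgebra F) (m : ℕ) : Prop :=
  θ ∈ augmentationIdeal F ^ m ∧ θ ∉ augmentationIdeal F ^ (m + 1)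

/-- The sum of the base `p` digits of `a`. -/
def digitSum (p a : ℕ) : ℕ := (Nat.digits p a).sum

/-! Everything takes place in the span of the Milnor operations on polynomials. By Milnor's product
formula (`seqOp_mul_seqOp`), the coefficient of `P(T)` in `P(R) P(S)` is the coefficient of `s^R
t^S` in the coproduct of `ξ^T`, where `Δ ξ_k = ∑ s_a^(q^b) t_b` over `a + b = k` and `s_0 = t_0 =
1`. Give `ξ^T` the weight `∑ w_k α(T_k)`. Sums of digits are subadditive and unchanged under
multiplication by `p`, so Frobenius powers cost nothing, and inequalities for the generators pass to
all monomials. If `w_a + w_b ≤ w_(a+b)`, each `P(T)` in `P(R) P(S)` has at least the weight of `R`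
plus that of `S`. If the inequality for `w` is strict, then so is this one, except for `T = R + S`,
whose coefficient is a product of binomial coefficients (`close_coprodMonomial`,
`exists_seqOp_mul`).

For `w_k = k` this shows that the `m`-th power of the augmentation ideal acts through combinations
of the `P(T)` of weight at least `m` (`steenrodAction_mem_weightSpan`). As the Milnor operations are
linearly independent, `P(R)` is in no power beyond its weight.

Conversely, `P(T)` lies in the power given by its weight (`seqOp_mem_filtration`). This goes by
induction on the degree and, within a degree, downwards on the strict weight `3k - 1`. If `T = R +
S` without carries, `P(R) P(S)` is a nonzero multiple of `P(T)` plus terms of larger strict weight.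
Otherwise `T` is a single `p^k` in position `t`. For `t = 1` this is a generator; for `t > 1` it
occurs in the commutator of `P(q^(t-1) p^k)` with the operation that has `p^k` in position `t - 1`,
and again all other terms have larger strict weight.

These are statements about operators. They carry over to the abstract algebra because it acts
faithfully (`steenrodAction_injective`): admissible monomials span, and their expansion in Milnor
operations is triangular.

In the code, sequences start at index `0`, so the weights `k`, `2k - 1`, `3k - 1` appear as `k + 1`,
`2 * k + 1`, `3 * k + 2`. -/

/-! ### Sums of digits -/

theorem digitSum_zero (p : ℕ) : digitSum p 0 = 0 := by simp [digitSum]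

theorem digitSum_mul_add {p : ℕ} (hp : 1 < p) (a : ℕ) {d : ℕ} (hd : d < p) :
    digitSum p (p * a + d) = digitSum p a + d := by
  unfold digitSum
  rcases Nat.eq_zero_or_pos (p * a + d) with h | h
  · have hd0 : d = 0 := by lia
    have ha0 : a = 0 := by
      have : p * a = 0 := by lia
      rcases Nat.mul_eq_zero.1 this with h | h <;> lia
    simp [hd0, ha0]
  · rw [add_comm (p * a) d, Nat.digits_add p hp d a hd (by
      rcases Nat.eq_zero_or_pos d with rfl | h'
      · right; rintro rfl; simp at h
      · exact Or.inl h'.ne')]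
    simp [add_comm]

theorem digitSum_mul {p : ℕ} (hp : 1 < p) (a : ℕ) : digitSum p (p * a) = digitSum p a :=
  digitSum_mul_add hp a (Nat.zero_lt_of_lt hp)

theorem digitSum_pow_mul {p : ℕ} (hp : 1 < p) (k a : ℕ) :
    digitSum p (p ^ k * a) = digitSum p a := by
  induction k with
  | zero => simp
  | succ k ih => rw [pow_succ', mul_assoc, digitSum_mul hp, ih]

theorem digitSum_one {p : ℕ} (hp : 1 < p) : digitSum p 1 = 1 := by
  have := digitSum_mul_add hp 0 hp
  simpa [digitSum_zero] using this

theorem digitSum_pow {p : ℕ} (hp : 1 < p) (k : ℕ) : digitSum p (p ^ k) = 1 := by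
  have := digitSum_pow_mul hp k 1
  rwa [mul_one, digitSum_one hp] at this

theorem digitSum_le (p a : ℕ) : digitSum p a ≤ a := Nat.digit_sum_le p a

theorem digitSum_eq_zero {p a : ℕ} (hp : 1 < p) (h : digitSum p a = 0) : a = 0 := by
  induction a using Nat.strong_induction_on with
  | _ a ih =>
    have hm := Nat.mod_lt a (Nat.zero_lt_of_lt hp)
    have h1 := digitSum_mul_add hp (a / p) hm
    rw [Nat.div_add_mod, h] at h1
    by_contra ha
    have h2 := ih (a / p) (Nat.div_lt_self (Nat.pos_of_ne_zero ha) hp) (by lia)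
    have h3 := Nat.div_add_mod a p
    rw [h2] at h3
    lia

/-- Legendre's formula `(p - 1) v_p(a!) = a - α(a)` for the three factorials. It yields both the
subadditivity of `α` and the nonvanishing mod `p` of the binomial coefficients of sums without
carries. -/
theorem digitSum_kummer {p : ℕ} (hp : p.Prime) (a b : ℕ) :
    (p - 1) * padicValNat p ((a + b).choose a) + digitSum p (a + b)
      = digitSum p a + digitSum p b := by
  have : Fact p.Prime := ⟨hp⟩
  have h1 := sub_one_mul_padicValNat_factorial (p := p) a
  have h2 := sub_one_mul_padicValNat_factorial (p := p) b
  have h3 := sub_one_mul_padicValNat_factorial (p := p) (a + b)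
  have h4 : padicValNat p (a + b).factorial = padicValNat p ((a + b).choose a)
      + padicValNat p a.factorial + padicValNat p b.factorial := by
    have h0 := (Nat.choose_pos (Nat.le_add_left b a)).ne'
    rw [Nat.choose_symm_add, ← Nat.add_choose_mul_factorial_mul_factorial a b, padicValNat.mul,
      padicValNat.mul]
    · exact h0
    · exact a.factorial_ne_zero
    · exact mul_ne_zero h0 a.factorial_ne_zero
    · exact b.factorial_ne_zero
  rw [h4, mul_add, mul_add, h1, h2] at h3
  have l1 := Nat.digit_sum_le p a
  have l2 := Nat.digit_sum_le p b
  have l3 := Nat.digit_sum_le p (a + b)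
  unfold digitSum
  lia

theorem digitSum_add_le {p : ℕ} (hp : p.Prime) (a b : ℕ) :
    digitSum p (a + b) ≤ digitSum p a + digitSum p b := by
  rw [← digitSum_kummer hp]; exact Nat.le_add_left _ _

theorem not_dvd_choose_of_digitSum_add {p : ℕ} (hp : p.Prime) {a b : ℕ}
    (h : digitSum p (a + b) = digitSum p a + digitSum p b) : ¬ p ∣ (a + b).choose a := by
  have : Fact p.Prime := ⟨hp⟩
  have h1 := digitSum_kummer hp a b
  have h2 : (p - 1) * padicValNat p ((a + b).choose a) = 0 := by lia
  have hp1 := hp.one_lt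
  have h3 : padicValNat p ((a + b).choose a) = 0 := by
    rcases Nat.mul_eq_zero.1 h2 with h | h
    · lia
    · exact h
  intro hd
  exact (one_le_padicValNat_of_dvd (Nat.choose_pos (Nat.le_add_right a b)).ne' hd).not_gt
    (by lia)

theorem eq_pow_of_digitSum_eq_one {p a : ℕ} (hp : 1 < p) (h : digitSum p a = 1) :
    ∃ k, a = p ^ k := by
  induction a using Nat.strong_induction_on with
  | _ a ih =>
    have hm := Nat.mod_lt a (Nat.zero_lt_of_lt hp)
    have h1 := digitSum_mul_add hp (a / p) hm
    rw [Nat.div_add_mod, h] at h1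
    have h3 := Nat.div_add_mod a p
    have ha : a ≠ 0 := by rintro rfl; simp [digitSum_zero] at h
    rcases Nat.eq_zero_or_pos (a % p) with h0 | h0
    · obtain ⟨k, hk⟩ := ih (a / p) (Nat.div_lt_self (Nat.pos_of_ne_zero ha) hp) (by lia)
      exact ⟨k + 1, by rw [pow_succ', ← hk]; lia⟩
    · have := digitSum_eq_zero hp (a := a / p) (by lia)
      rw [this] at h1 h3
      exact ⟨0, by simp; lia⟩

/-- A unit is split off from the lowest nonzero digit, which causes no carry. -/
theorem exists_add_of_digitSum {p a : ℕ} (hp : 1 < p) (h : 1 < digitSum p a) :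
    ∃ b c, b ≠ 0 ∧ c ≠ 0 ∧ b + c = a ∧ digitSum p (b + c) = digitSum p b + digitSum p c := by
  induction a using Nat.strong_induction_on with
  | _ a ih =>
    have hm := Nat.mod_lt a (Nat.zero_lt_of_lt hp)
    have h1 := digitSum_mul_add hp (a / p) hm
    have h3 := Nat.div_add_mod a p
    rw [h3] at h1
    have ha : a ≠ 0 := by rintro rfl; simp [digitSum_zero] at h
    rcases Nat.eq_zero_or_pos (a % p) with h0 | h0
    · obtain ⟨b, c, hb, hc, hbc, hd⟩ :=
        ih (a / p) (Nat.div_lt_self (Nat.pos_of_ne_zero ha) hp) (by lia)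
      refine ⟨p * b, p * c, ?_, ?_, ?_, ?_⟩
      · exact mul_ne_zero (by lia) hb
      · exact mul_ne_zero (by lia) hc
      · rw [← mul_add, hbc]; lia
      · rw [← mul_add, digitSum_mul hp, digitSum_mul hp, digitSum_mul hp, hd]
    · have h2 := digitSum_mul_add hp (a / p) (d := a % p - 1) (by lia)
      have e : p * (a / p) + (a % p - 1) = a - 1 := by lia
      rw [e] at h2
      refine ⟨1, a - 1, one_ne_zero, ?_, by lia, ?_⟩
      · intro h4
        rw [h4, digitSum_zero] at h2
        lia
      · rw [digitSum_one hp, show 1 + (a - 1) = a by lia]; lia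

/-! ### Weighted sums of digits of exponent sequences -/

/-- The sum of `w k * α (T k)`, where `α` is the sum of digits in base `p`. -/
def digitWeight (p : ℕ) (w : ℕ → ℕ) (T : ℕ →₀ ℕ) : ℕ := T.sum fun k a => w k * digitSum p a

section
variable {p : ℕ} (w : ℕ → ℕ)

theorem digitWeight_eq_sum (T : ℕ →₀ ℕ) {s : Finset ℕ} (hs : T.support ⊆ s) :
    digitWeight p w T = ∑ k ∈ s, w k * digitSum p (T k) :=
  Finsupp.sum_of_support_subset _ hs _ (by simp [digitSum_zero])

theorem digitWeight_zero : digitWeight p w 0 = 0 := by simp [digitWeight]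

theorem digitWeight_single (k a : ℕ) :
    digitWeight p w (Finsupp.single k a) = w k * digitSum p a := by
  simp [digitWeight, digitSum_zero]

theorem digitWeight_add_le (hp : p.Prime) (R S : ℕ →₀ ℕ) :
    digitWeight p w (R + S) ≤ digitWeight p w R + digitWeight p w S := by
  classical
  rw [digitWeight_eq_sum w (R + S) (s := R.support ∪ S.support) Finsupp.support_add,
    digitWeight_eq_sum w R Finset.subset_union_left,
    digitWeight_eq_sum w S Finset.subset_union_right, ← Finset.sum_add_distrib]
  refine Finset.sum_le_sum fun k _ => ?_
  rw [← mul_add]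
  exact Nat.mul_le_mul_left _ (digitSum_add_le hp _ _)

theorem digitWeight_add_of_digitSum (R S : ℕ →₀ ℕ)
    (h : ∀ k, digitSum p (R k + S k) = digitSum p (R k) + digitSum p (S k)) :
    digitWeight p w (R + S) = digitWeight p w R + digitWeight p w S := by
  classical
  rw [digitWeight_eq_sum w (R + S) (s := R.support ∪ S.support) Finsupp.support_add,
    digitWeight_eq_sum w R Finset.subset_union_left,
    digitWeight_eq_sum w S Finset.subset_union_right, ← Finset.sum_add_distrib]
  refine Finset.sum_congr rfl fun k _ => ?_
  rw [← mul_add, Finsupp.add_apply, h]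

theorem digitWeight_smul (hp : p.Prime) (R : ℕ →₀ ℕ) :
    digitWeight p w (p • R) = digitWeight p w R := by
  rw [digitWeight_eq_sum w (p • R) (s := R.support) Finsupp.support_smul,
    digitWeight_eq_sum w R subset_rfl]
  refine Finset.sum_congr rfl fun k _ => ?_
  rw [Finsupp.smul_apply, smul_eq_mul, digitSum_mul hp.one_lt]

theorem eq_zero_of_digitWeight_eq_zero (hp : p.Prime) (hw : ∀ k, w k ≠ 0) {T : ℕ →₀ ℕ}
    (h : digitWeight p w T = 0) : T = 0 := by
  ext k
  by_contra hk
  have hk' : k ∈ T.support := Finsupp.mem_support_iff.2 hk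
  have := (Finset.sum_eq_zero_iff.1 h) k hk'
  rcases Nat.mul_eq_zero.1 this with h | h
  · exact hw k h
  · exact hk (digitSum_eq_zero hp.one_lt h)

/-- A nonzero exponent sequence is a single power of `p` or a sum without carries of two nonzero
sequences. -/
theorem eq_single_or_exists_add (hp : p.Prime) {T : ℕ →₀ ℕ} (hT : T ≠ 0) :
    (∃ t k, T = Finsupp.single t (p ^ k)) ∨ ∃ R S : ℕ →₀ ℕ, R ≠ 0 ∧ S ≠ 0 ∧ R + S = T ∧
      ∀ k, digitSum p (R k + S k) = digitSum p (R k) + digitSum p (S k) := by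
  obtain ⟨t, ht⟩ : ∃ t, T t ≠ 0 := by
    by_contra! h
    exact hT (Finsupp.ext h)
  by_cases hE : T.erase t = 0
  · have hs : T = Finsupp.single t (T t) := by
      have := Finsupp.single_add_erase t T
      rw [hE, add_zero] at this
      exact this.symm
    rcases lt_or_ge 1 (digitSum p (T t)) with h | h
    · right
      obtain ⟨b, c, hb, hc, hbc, hd⟩ := exists_add_of_digitSum hp.one_lt h
      refine ⟨Finsupp.single t b, Finsupp.single t c, by simpa, by simpa, ?_, ?_⟩
      · rw [← Finsupp.single_add, hbc, ← hs]
      · intro k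
        by_cases hk : k = t
        · subst hk; simpa using hd
        · simp [Ne.symm hk, digitSum_zero]
    · left
      have h0 : digitSum p (T t) ≠ 0 := fun h => ht (digitSum_eq_zero hp.one_lt h)
      obtain ⟨k, hk⟩ := eq_pow_of_digitSum_eq_one hp.one_lt (a := T t) (by lia)
      exact ⟨t, k, hk ▸ hs⟩
  · right
    refine ⟨Finsupp.single t (T t), T.erase t, by simpa, hE, Finsupp.single_add_erase t T, ?_⟩
    intro k
    by_cases hk : k = t
    · subst hk; simp [digitSum_zero]
    · simp [Ne.symm hk, digitSum_zero]

end

/-! ### Filtrations of polynomial rings in two sequences of variables -/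

section
open MvPolynomial
variable {K : Type*} [CommRing K]

/-- The coefficient of `s ^ R * t ^ S` in a polynomial in `t` over the polynomials in `s`. -/
noncomputable def bicoeff (R S : ℕ →₀ ℕ) (z : MvPolynomial ℕ (MvPolynomial ℕ K)) : K :=
  (z.coeff S).coeff R

theorem bicoeff_add (R S : ℕ →₀ ℕ) (z z' : MvPolynomial ℕ (MvPolynomial ℕ K)) :
    bicoeff R S (z + z') = bicoeff R S z + bicoeff R S z' := by simp [bicoeff]

theorem bicoeff_sub (R S : ℕ →₀ ℕ) (z z' : MvPolynomial ℕ (MvPolynomial ℕ K)) :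
    bicoeff R S (z - z') = bicoeff R S z - bicoeff R S z' := by simp [bicoeff]

theorem bicoeff_monomial (R S R' S' : ℕ →₀ ℕ) (c : K) :
    bicoeff R S (monomial S' (monomial R' c)) = if S' = S ∧ R' = R then c else 0 := by
  classical
  rw [bicoeff, coeff_monomial]
  by_cases h : S' = S
  · simp [h, coeff_monomial]
  · simp [h]

theorem exists_of_bicoeff_mul_ne_zero {R S : ℕ →₀ ℕ}
    {z z' : MvPolynomial ℕ (MvPolynomial ℕ K)} (h : bicoeff R S (z * z') ≠ 0) :
    ∃ R₁ R₂ S₁ S₂, R₁ + R₂ = R ∧ S₁ + S₂ = S ∧ bicoeff R₁ S₁ z ≠ 0 ∧ bicoeff R₂ S₂ z' ≠ 0 := by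
  classical
  rw [bicoeff, coeff_mul, coeff_sum] at h
  obtain ⟨x, hx, h⟩ := Finset.exists_ne_zero_of_sum_ne_zero h
  rw [coeff_mul] at h
  obtain ⟨y, hy, h⟩ := Finset.exists_ne_zero_of_sum_ne_zero h
  exact ⟨y.1, y.2, x.1, x.2, Finset.HasAntidiagonal.mem_antidiagonal.1 hy, Finset.HasAntidiagonal.mem_antidiagonal.1 hx,
    left_ne_zero_of_mul h, right_ne_zero_of_mul h⟩

/-- Frobenius is additive, so `z ^ p` has the exponents of `z` multiplied by `p` and the
coefficients raised to the `p`-th power. The coefficient ring is arbitrary so that this can be used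
for `t` and then again for `s`. -/
theorem exists_of_coeff_pow_char_ne_zero {L : Type*} [CommRing L] {p : ℕ} [Fact p.Prime]
    [CharP L p] {S : ℕ →₀ ℕ} {z : MvPolynomial ℕ L} (h : (z ^ p).coeff S ≠ 0) :
    ∃ S', S = p • S' ∧ (z ^ p).coeff S = z.coeff S' ^ p := by
  classical
  have h1 : z ^ p = ∑ m ∈ z.support, monomial (p • m) (z.coeff m ^ p) := by
    conv_lhs => rw [z.as_sum]
    rw [sum_pow_char]
    simp [monomial_pow]
  have h2 : ∀ S', (z ^ p).coeff (p • S') = z.coeff S' ^ p := by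
    intro S'
    have hp : p ≠ 0 := (Fact.out : p.Prime).ne_zero
    have hinj : ∀ m : ℕ →₀ ℕ, p • m = p • S' ↔ m = S' := fun m => by
      constructor
      · intro h
        ext i
        have := DFunLike.congr_fun h i
        simpa [hp] using this
      · rintro rfl; rfl
    rw [h1, coeff_sum]
    simp only [coeff_monomial, hinj]
    rw [Finset.sum_ite_eq']
    split_ifs with h
    · rfl
    · rw [notMem_support_iff.1 h, zero_pow hp]
  have h0 := h
  rw [h1, coeff_sum] at h
  obtain ⟨m, _, hm⟩ := Finset.exists_ne_zero_of_sum_ne_zero h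
  rw [coeff_monomial] at hm
  have : p • m = S := by
    by_contra hne
    exact hm (if_neg hne)
  exact ⟨m, this.symm, by rw [← this]; exact h2 m⟩

theorem exists_of_bicoeff_pow_char_ne_zero {p : ℕ} [Fact p.Prime] [CharP K p] {R S : ℕ →₀ ℕ}
    {z : MvPolynomial ℕ (MvPolynomial ℕ K)} (h : bicoeff R S (z ^ p) ≠ 0) :
    ∃ R' S', R = p • R' ∧ S = p • S' ∧ bicoeff R' S' z ≠ 0 := by
  have hp : p ≠ 0 := (Fact.out : p.Prime).ne_zero
  have h1 : (z ^ p).coeff S ≠ 0 := by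
    intro h0
    rw [bicoeff, h0] at h
    simp at h
  obtain ⟨S', hS, e⟩ := exists_of_coeff_pow_char_ne_zero h1
  rw [bicoeff, e] at h
  obtain ⟨R', hR, e'⟩ := exists_of_coeff_pow_char_ne_zero h
  rw [e'] at h
  exact ⟨R', S', hR, hS, fun h0 => h (by rw [← bicoeff, h0, zero_pow hp])⟩

/-- All monomials `s ^ R * t ^ S` that occur in `z` have `v R S ≤ d`. -/
def Bounded (v : (ℕ →₀ ℕ) → (ℕ →₀ ℕ) → ℤ) (d : ℤ)
    (z : MvPolynomial ℕ (MvPolynomial ℕ K)) : Prop :=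
  ∀ R S, bicoeff R S z ≠ 0 → v R S ≤ d

/-- `z` and `z'` are bounded by `d` and differ by terms bounded by `d - ε`. -/
def Close (v : (ℕ →₀ ℕ) → (ℕ →₀ ℕ) → ℤ) (ε d : ℤ)
    (z z' : MvPolynomial ℕ (MvPolynomial ℕ K)) : Prop :=
  Bounded v d z ∧ Bounded v d z' ∧ Bounded v (d - ε) (z - z')

/-- Functions compatible with the multiplication of monomials. -/
def IsSubadd (v : (ℕ →₀ ℕ) → (ℕ →₀ ℕ) → ℤ) : Prop :=
  v 0 0 = 0 ∧ ∀ R R' S S', v (R + R') (S + S') ≤ v R S + v R' S'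

variable {v : (ℕ →₀ ℕ) → (ℕ →₀ ℕ) → ℤ} {ε d d' : ℤ} {z z' w w' : MvPolynomial ℕ (MvPolynomial ℕ K)}

theorem Bounded.add (hz : Bounded v d z) (hw : Bounded v d w) : Bounded v d (z + w) := by
  intro R S h
  rw [bicoeff_add] at h
  by_cases h1 : bicoeff R S z = 0
  · rw [h1, zero_add] at h; exact hw R S h
  · exact hz R S h1

theorem Bounded.zero : Bounded v d (0 : MvPolynomial ℕ (MvPolynomial ℕ K)) := by
  intro R S h
  simp [bicoeff] at h

theorem Bounded.sum {ι : Type*} {s : Finset ι} {f : ι → MvPolynomial ℕ (MvPolynomial ℕ K)}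
    (h : ∀ i ∈ s, Bounded v d (f i)) : Bounded v d (∑ i ∈ s, f i) :=
  Finset.sum_induction f (Bounded v d) (fun _ _ => Bounded.add) Bounded.zero h

theorem Bounded.mono (hz : Bounded v d z) (h : d ≤ d') : Bounded v d' z :=
  fun R S h' => (hz R S h').trans h

theorem Bounded.mul (hv : IsSubadd v) (hz : Bounded v d z) (hw : Bounded v d' w) :
    Bounded v (d + d') (z * w) := by
  intro R S h
  obtain ⟨R₁, R₂, S₁, S₂, rfl, rfl, h1, h2⟩ := exists_of_bicoeff_mul_ne_zero h
  exact (hv.2 _ _ _ _).trans (add_le_add (hz _ _ h1) (hw _ _ h2))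

theorem Bounded.one (hv : IsSubadd v) : Bounded v 0 (1 : MvPolynomial ℕ (MvPolynomial ℕ K)) := by
  intro R S h
  have h1 : bicoeff R S (1 : MvPolynomial ℕ (MvPolynomial ℕ K)) = _ :=
    bicoeff_monomial R S 0 0 1
  rw [h1] at h
  split_ifs at h with h2
  · rw [← h2.1, ← h2.2, hv.1]
  · exact absurd rfl h

theorem Bounded.pow_char {p : ℕ} [Fact p.Prime] [CharP K p]
    (hv : ∀ R S, v (p • R) (p • S) = v R S) (hz : Bounded v d z) : Bounded v d (z ^ p) := by
  intro R S h
  obtain ⟨R', S', rfl, rfl, h1⟩ := exists_of_bicoeff_pow_char_ne_zero h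
  rw [hv]
  exact hz _ _ h1

/-- With this, a mere bound can be passed through the multiplicative lemmas for `Close`. -/
theorem Bounded.close (hz : Bounded v d z) : Close v ε d z z :=
  ⟨hz, hz, by rw [sub_self]; exact Bounded.zero⟩

theorem Close.mul (hv : IsSubadd v) (hz : Close v ε d z z') (hw : Close v ε d' w w') :
    Close v ε (d + d') (z * w) (z' * w') := by
  refine ⟨hz.1.mul hv hw.1, hz.2.1.mul hv hw.2.1, ?_⟩
  have h1 := hz.2.2.mul hv hw.1
  have h2 := hz.2.1.mul hv hw.2.2
  have e : z * w - z' * w' = (z - z') * w + z' * (w - w') := by ring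
  rw [e]
  exact (h1.mono (by lia)).add (h2.mono (by lia))

theorem Close.one (hv : IsSubadd v) :
    Close v ε 0 (1 : MvPolynomial ℕ (MvPolynomial ℕ K)) 1 := (Bounded.one hv).close

theorem Close.pow (hv : IsSubadd v) (hz : Close v ε d z z') (a : ℕ) :
    Close v ε (d * a) (z ^ a) (z' ^ a) := by
  induction a with
  | zero => simpa using Close.one hv
  | succ a ih =>
    rw [pow_succ, pow_succ]
    have := ih.mul hv hz
    rwa [← mul_add_one, ← Nat.cast_succ] at this

theorem Close.pow_char {p : ℕ} [Fact p.Prime] [CharP K p]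
    (hv : ∀ R S, v (p • R) (p • S) = v R S) (hz : Close v ε d z z') :
    Close v ε d (z ^ p) (z' ^ p) := by
  refine ⟨hz.1.pow_char hv, hz.2.1.pow_char hv, ?_⟩
  rw [← sub_pow_char]
  exact hz.2.2.pow_char hv

/-- Write `a = p * (a / p) + a % p`. The `p`-th power leaves the bound as it is, and the last digit
contributes `a % p` ordinary factors; so the bound grows with the sum of the digits and not with
`a`. -/
theorem Close.pow_digitSum {p : ℕ} [Fact p.Prime] [CharP K p] (hv : IsSubadd v)
    (hv' : ∀ R S, v (p • R) (p • S) = v R S) (hz : Close v ε d z z') (a : ℕ) :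
    Close v ε (d * digitSum p a) (z ^ a) (z' ^ a) := by
  have hp : p.Prime := Fact.out
  induction a using Nat.strong_induction_on with
  | _ a ih =>
    rcases Nat.eq_zero_or_pos a with rfl | ha
    · simpa [digitSum_zero] using Close.one hv
    · have hm := Nat.mod_lt a hp.pos
      have h1 := digitSum_mul_add hp.one_lt (a / p) hm
      have h2 : p * (a / p) + a % p = a := Nat.div_add_mod a p
      have h3 := ((ih (a / p) (Nat.div_lt_self ha hp.one_lt)).pow_char hv').mul hv
        (hz.pow hv (a % p))
      rw [← pow_mul, ← pow_mul, ← pow_add, ← pow_add, mul_comm (a / p) p, h2, ← mul_add,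
        ← Nat.cast_add, ← h1, h2] at h3
      exact h3

/-- The cost `c` of a power is left open: it is `d * a` for gradings and `d * α(a)` for digit
weights. -/
theorem Close.finsuppProd (hv : IsSubadd v) {f g : ℕ → MvPolynomial ℕ (MvPolynomial ℕ K)}
    {c : ℕ → ℕ → ℤ} (h : ∀ k a, Close v ε (c k a) (f k ^ a) (g k ^ a)) (T : ℕ →₀ ℕ) :
    Close v ε (T.sum c) (T.prod fun k a => f k ^ a) (T.prod fun k a => g k ^ a) := by
  unfold Finsupp.sum Finsupp.prod
  generalize T.support = s
  classical
  induction s using Finset.induction_on with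
  | empty => simpa using Close.one hv
  | insert k s hk ih =>
    rw [Finset.sum_insert hk, Finset.prod_insert hk, Finset.prod_insert hk]
    exact (h k (T k)).mul hv ih

end

/-! ### The coproduct of the dual algebra -/

section
open MvPolynomial
variable (K : Type*) [CommRing K]

/-- The exponent sequence of the `i`-th Milnor generator, which is `1` for `i = 0` and the variable
with index `i - 1` for `i > 0`. -/
noncomputable def genExp : ℕ → (ℕ →₀ ℕ)
  | 0 => 0
  | i + 1 => Finsupp.single i 1

theorem genExp_zero : genExp 0 = 0 := rfl

theorem genExp_succ (i : ℕ) : genExp (i + 1) = Finsupp.single i 1 := rfl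

/-- The `i`-th Milnor generator, replaced by `0` for `i > n`. -/
noncomputable def milnorGen (n i : ℕ) : MvPolynomial ℕ K :=
  if i ≤ n then monomial (genExp i) 1 else 0

theorem milnorGen_zero (n : ℕ) : milnorGen K n 0 = 1 := by
  simp [milnorGen, genExp_zero]

theorem milnorGen_succ {n i : ℕ} (h : i < n) : milnorGen K n (i + 1) = X i := by
  rw [milnorGen, if_pos (by lia), genExp_succ, X]

theorem milnorGen_of_lt {n i : ℕ} (h : n < i) : milnorGen K n i = 0 := by
  rw [milnorGen, if_neg (by lia)]

theorem map_milnorGen {L : Type*} [CommRing L] (f : K →+* L) (n i : ℕ) :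
    map f (milnorGen K n i) = milnorGen L n i := by
  unfold milnorGen
  split_ifs <;> simp

variable (q : ℕ)

/-- The coproduct of the `k`-th Milnor generator, `∑ s_a ^ (q ^ b) * t_b` over `a + b = k`. -/
noncomputable def coprodGen (n k : ℕ) : MvPolynomial ℕ (MvPolynomial ℕ K) :=
  ∑ x ∈ Finset.HasAntidiagonal.antidiagonal k,
    C (milnorGen K n x.1 ^ q ^ x.2) * milnorGen (MvPolynomial ℕ K) n x.2

theorem coprodGen_zero (n : ℕ) : coprodGen K q n 0 = 1 := by
  simp [coprodGen, milnorGen_zero]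

theorem map_coprodGen {L : Type*} [CommRing L] (f : K →+* L) (n k : ℕ) :
    map (map f) (coprodGen K q n k) = coprodGen L q n k := by
  simp only [coprodGen, map_sum, map_mul, map_C, map_pow, map_milnorGen]

/-- The coproduct of a monomial. -/
noncomputable def coprodMonomial (n : ℕ) (T : ℕ →₀ ℕ) : MvPolynomial ℕ (MvPolynomial ℕ K) :=
  T.prod fun k a => coprodGen K q n (k + 1) ^ a

theorem map_coprodMonomial {L : Type*} [CommRing L] (f : K →+* L) (n : ℕ) (T : ℕ →₀ ℕ) :
    map (map f) (coprodMonomial K q n T) = coprodMonomial L q n T := by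
  simp only [coprodMonomial, Finsupp.prod, map_prod, map_pow, map_coprodGen]

variable {K q} {v : (ℕ →₀ ℕ) → (ℕ →₀ ℕ) → ℤ} {d : ℤ}

theorem bounded_coprod_term (n a b c : ℕ) (h : v (c • genExp a) (genExp b) ≤ d) :
    Bounded v d (C (milnorGen K n a ^ c) * milnorGen (MvPolynomial ℕ K) n b) := by
  unfold milnorGen
  by_cases hb : b ≤ n
  · by_cases ha : a ≤ n
    · rw [if_pos hb, if_pos ha, monomial_pow, C_mul_monomial, mul_one, one_pow]
      intro R S h'
      rw [bicoeff_monomial] at h'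
      split_ifs at h' with h2
      · rwa [← h2.1, ← h2.2]
      · exact absurd rfl h'
    · rw [if_neg ha, if_pos hb]
      -- A generator beyond the truncation is `0`, but `0 ^ 0 = 1`, so for `c = 0` the term
      -- survives.
      rcases Nat.eq_zero_or_pos c with rfl | hc
      · rw [pow_zero, C_1, one_mul]
        intro R S h'
        have h1 : bicoeff R S (monomial (genExp b) (1 : MvPolynomial ℕ K)) = _ :=
          bicoeff_monomial R S 0 (genExp b) 1
        rw [h1] at h'
        split_ifs at h' with h2
        · rwa [← h2.1, ← h2.2, ← zero_smul ℕ (genExp a)]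
        · exact absurd rfl h'
      · rw [zero_pow hc.ne', C_0, zero_mul]
        exact Bounded.zero
  · rw [if_neg hb, mul_zero]
    exact Bounded.zero

theorem bounded_coprodGen (n k : ℕ)
    (h : ∀ a b, a + b = k → v (q ^ b • genExp a) (genExp b) ≤ d) :
    Bounded v d (coprodGen K q n k) :=
  Bounded.sum fun x hx => bounded_coprod_term n x.1 x.2 _ (h _ _ (Finset.HasAntidiagonal.mem_antidiagonal.1 hx))

end

/-! ### Filtrations and leading terms of the coproduct -/

section
open MvPolynomial

/-- The degree of `P(T)` divided by the degree of `P(1)` over `q - 1`, so that `P^r` has degree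
`(q - 1) r`. -/
noncomputable def milnorDegree (q : ℕ) : (ℕ →₀ ℕ) →+ ℕ := Finsupp.weight fun k => q ^ (k + 1) - 1

/-- The first exponent `∑ q ^ k T_k` of the admissible sequence that belongs to `T`. -/
noncomputable def leadExp (q : ℕ) : (ℕ →₀ ℕ) →+ ℕ := Finsupp.weight fun k => q ^ k

/-- The shift `(T₁, T₂, …)` of a sequence `(T₀, T₁, …)`. -/
noncomputable def shiftExp (T : ℕ →₀ ℕ) : ℕ →₀ ℕ :=
  T.comapDomain Nat.succ Nat.succ_injective.injOn

theorem shiftExp_apply (T : ℕ →₀ ℕ) (k : ℕ) : shiftExp T k = T (k + 1) := rfl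

theorem milnorDegree_single (q k a : ℕ) :
    milnorDegree q (Finsupp.single k a) = a * (q ^ (k + 1) - 1) := by
  simp [milnorDegree, Finsupp.weight_single]

theorem leadExp_single (q k a : ℕ) : leadExp q (Finsupp.single k a) = a * q ^ k := by
  simp [leadExp, Finsupp.weight_single]

theorem le_mul_milnorDegree {q : ℕ} (hq : 1 < q) (T : ℕ →₀ ℕ) (k : ℕ) :
    (k + 1) * T k ≤ milnorDegree q T := by
  have h1 : T k * (q ^ (k + 1) - 1) ≤ milnorDegree q T := by
    conv_rhs => rw [← Finsupp.single_add_erase k T]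
    rw [map_add, milnorDegree_single]
    exact Nat.le_add_right _ _
  have h2 : k + 1 ≤ q ^ (k + 1) - 1 := by
    have := Nat.lt_pow_self hq (n := k + 1)
    lia
  calc (k + 1) * T k = T k * (k + 1) := mul_comm _ _
    _ ≤ T k * (q ^ (k + 1) - 1) := Nat.mul_le_mul_left _ h2
    _ ≤ _ := h1

theorem lt_of_mem_support_of_milnorDegree_le {q : ℕ} (hq : 1 < q) {T : ℕ →₀ ℕ} {D k : ℕ}
    (hT : milnorDegree q T ≤ D) (hk : k ∈ T.support) : k < D := by
  have h1 := le_mul_milnorDegree hq T k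
  have h2 : 1 ≤ T k := Nat.one_le_iff_ne_zero.2 (Finsupp.mem_support_iff.1 hk)
  have h3 : (k + 1) * 1 ≤ (k + 1) * T k := Nat.mul_le_mul_left _ h2
  lia

/-- Both the positions and the exponents of `T` are bounded by its degree. This makes the expansion
of a product of two Milnor operations finite. -/
theorem finite_milnorDegree_le {q : ℕ} (hq : 1 < q) (D : ℕ) :
    {T | milnorDegree q T ≤ D}.Finite := by
  classical
  refine (Finset.finite_toSet (Finset.Iic (∑ k ∈ Finset.range D, Finsupp.single k D))).subset ?_
  intro T hT
  simp only [Set.mem_ofPred_eq] at hT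
  simp only [Finset.coe_Iic, Set.mem_Iic]
  intro k
  rw [Finsupp.finsetSum_apply]
  by_cases hk : k ∈ T.support
  · have h1 := lt_of_mem_support_of_milnorDegree_le hq hT hk
    rw [Finset.sum_eq_single k]
    · have h2 := le_mul_milnorDegree hq T k
      have h3 : 1 * T k ≤ (k + 1) * T k := Nat.mul_le_mul_right _ (by lia)
      simp only [Finsupp.single_eq_same]
      lia
    · intro b _ hb
      simp [hb.symm]
    · intro h
      exact absurd (Finset.mem_range.2 h1) h
  · rw [Finsupp.notMem_support_iff.1 hk]
    exact Nat.zero_le _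

theorem milnorDegree_eq_zero {q : ℕ} (hq : 1 < q) {T : ℕ →₀ ℕ} (h : milnorDegree q T = 0) :
    T = 0 := by
  ext k
  have := le_mul_milnorDegree hq T k
  rw [h] at this
  rcases Nat.mul_eq_zero.1 (Nat.le_zero.1 this) with h | h
  · lia
  · exact h

theorem milnorDegree_genExp {q : ℕ} (hq : 0 < q) (a : ℕ) :
    (milnorDegree q (genExp a) : ℤ) = (q : ℤ) ^ a - 1 := by
  cases a with
  | zero => simp [genExp_zero]
  | succ a =>
    rw [genExp_succ, milnorDegree_single, one_mul, Nat.cast_sub (Nat.one_le_pow _ _ hq)]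
    push_cast; rfl

variable {K : Type*} [CommRing K]

theorem milnorDegree_of_bicoeff_ne_zero {q : ℕ} (hq : 0 < q) {n : ℕ} {R S T : ℕ →₀ ℕ}
    (h : bicoeff R S (coprodMonomial K q n T) ≠ 0) :
    milnorDegree q T = milnorDegree q R + milnorDegree q S := by
  have hz : ∀ s : ℤ, s * (milnorDegree q R + milnorDegree q S : ℕ) ≤ s * milnorDegree q T := by
    intro s
    -- The coproduct preserves degrees. The bounds are one-sided, so the degree is used with the
    -- factors `s = 1` and `s = -1` to get an equality.
    let v : (ℕ →₀ ℕ) → (ℕ →₀ ℕ) → ℤ := fun R S => s * (milnorDegree q R + milnorDegree q S : ℕ)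
    have hv : IsSubadd v := ⟨by simp [v], fun R R' S S' => by
      simp only [v, map_add, ← mul_add, ← Nat.cast_add]
      refine le_of_eq ?_
      congr 2
      ring⟩
    have hb : ∀ k, Bounded v (s * (q ^ (k + 1) - 1 : ℕ)) (coprodGen K q n (k + 1)) := by
      intro k
      refine bounded_coprodGen n (k + 1) fun a b hab => le_of_eq ?_
      simp only [v, map_nsmul, Nat.cast_add, smul_eq_mul, Nat.cast_mul, milnorDegree_genExp hq]
      rw [Nat.cast_sub (Nat.one_le_pow _ _ hq), ← hab, pow_add]
      push_cast; ring
    have hc := (Close.finsuppProd (ε := 0) hv (fun k a => ((hb k).close.pow hv a)) T).1 R S h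
    refine hc.trans (le_of_eq ?_)
    rw [milnorDegree, Finsupp.weight_apply, Finsupp.sum, Finsupp.sum, Nat.cast_sum, Finset.mul_sum]
    refine Finset.sum_congr rfl fun k _ => ?_
    rw [smul_eq_mul]; push_cast; ring
  have h1 := hz 1
  have h2 := hz (-1)
  lia

/-- Each term of the coproduct of a generator contains at most one variable `t_b`, and that to the
first power. -/
theorem degree_le_of_bicoeff_ne_zero {q n : ℕ} {R S T : ℕ →₀ ℕ}
    (h : bicoeff R S (coprodMonomial K q n T) ≠ 0) : S.degree ≤ T.degree := by
  let v : (ℕ →₀ ℕ) → (ℕ →₀ ℕ) → ℤ := fun _ S => S.degree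
  have hv : IsSubadd v := ⟨by simp [v], fun R R' S S' => by simp [v]⟩
  have hb : ∀ k, Bounded v 1 (coprodGen K q n (k + 1)) := by
    intro k
    refine bounded_coprodGen n (k + 1) fun a b hab => ?_
    cases b <;> simp [v, genExp]
  have hc := (Close.finsuppProd (ε := 0) hv (fun k a => ((hb k).close.pow hv a)) T).1 R S h
  have e : (T.sum fun _ a => (1 : ℤ) * a) = T.degree := by
    simp [Finsupp.sum, Finsupp.degree_apply]
  rw [e] at hc
  exact (Nat.cast_le (α := ℤ)).1 hc

/-- The product of the primitive parts of the coproducts of the generators in a monomial. -/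
noncomputable def primMonomial (K : Type*) [CommRing K] (n : ℕ) (T : ℕ →₀ ℕ) :
    MvPolynomial ℕ (MvPolynomial ℕ K) :=
  T.prod fun k a => (C (milnorGen K n (k + 1)) + milnorGen (MvPolynomial ℕ K) n (k + 1)) ^ a

/-- A mixed term `s_a^(q^b) t_b` with `a, b ≥ 1` has weight at least `ε` below that of `ξ_(a+b)`,
since the exponent `q^b` has digit sum `1`. So up to `ε` only the primitive part `s_k + t_k` matters
for a generator, and `Close.pow_digitSum` carries this over to monomials. With `ε = 0` only the
bound itself is of use; with `ε = 1` the mixed terms are strictly lower. -/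
theorem close_coprodMonomial {p : ℕ} [Fact p.Prime] [CharP K p] (e n ε : ℕ) {w : ℕ → ℕ}
    (hw : ∀ i j, w i + w j + ε ≤ w (i + j + 1)) (T : ℕ →₀ ℕ) :
    Close (fun R S => (digitWeight p w R + digitWeight p w S : ℕ)) ε (digitWeight p w T)
      (coprodMonomial K (p ^ e) n T) (primMonomial K n T) := by
  have hp : p.Prime := Fact.out
  set v : (ℕ →₀ ℕ) → (ℕ →₀ ℕ) → ℤ := fun R S => (digitWeight p w R + digitWeight p w S : ℕ)
  have hv : IsSubadd v := ⟨by simp [v, digitWeight_zero], fun R R' S S' => by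
    simp only [v]
    have h1 := digitWeight_add_le w hp R R'
    have h2 := digitWeight_add_le w hp S S'
    push_cast
    lia⟩
  have hv' : ∀ R S, v (p • R) (p • S) = v R S := fun R S => by
    simp only [v, digitWeight_smul w hp]
  have hg : ∀ c a, digitWeight p w ((p ^ c) • genExp (a + 1)) = w a := fun c a => by
    rw [genExp_succ, Finsupp.smul_single, digitWeight_single, smul_eq_mul, mul_one,
      digitSum_pow hp.one_lt, mul_one]
  have hg' : ∀ a, digitWeight p w (genExp (a + 1)) = w a := fun a => by
    simpa using hg 0 a
  have hb : ∀ k, Close v ε (w k) (coprodGen K (p ^ e) n (k + 1))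
      (C (milnorGen K n (k + 1)) + milnorGen (MvPolynomial ℕ K) n (k + 1)) := by
    intro k
    have h1 : Bounded v (w k : ℤ)
        (C (milnorGen K n (k + 1)) + milnorGen (MvPolynomial ℕ K) n (k + 1)) := by
      refine Bounded.add ?_ ?_
      · have := bounded_coprod_term (K := K) (v := v) (d := w k) n (k + 1) 0 1 (by
          simp [v, genExp_zero, digitWeight_zero, hg'])
        simpa [milnorGen_zero] using this
      · have := bounded_coprod_term (K := K) (v := v) (d := w k) n 0 (k + 1) 1 (by
          simp [v, genExp_zero, digitWeight_zero, hg'])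
        simpa [milnorGen_zero] using this
    have h2 : Bounded v (w k - ε : ℤ) (coprodGen K (p ^ e) n (k + 1) -
        (C (milnorGen K n (k + 1)) + milnorGen (MvPolynomial ℕ K) n (k + 1))) := by
      -- `Finset.Nat.antidiagonal_succ` splits off the term `t_(k+1)` and lowers the index of `s` by
      -- one in the others; among these, `x.2 = 0` is the other primitive term `s_(k+1)`.
      have hs : coprodGen K (p ^ e) n (k + 1) -
        (C (milnorGen K n (k + 1)) + milnorGen (MvPolynomial ℕ K) n (k + 1)) =
          ∑ x ∈ Finset.HasAntidiagonal.antidiagonal k, if x.2 = 0 then 0 else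
            C (milnorGen K n (x.1 + 1) ^ (p ^ e) ^ x.2) * milnorGen (MvPolynomial ℕ K) n x.2 := by
        have h0 : ∑ x ∈ Finset.HasAntidiagonal.antidiagonal k,
            C (milnorGen K n (x.1 + 1) ^ (p ^ e) ^ x.2) * milnorGen (MvPolynomial ℕ K) n x.2 =
            C (milnorGen K n (k + 1)) + ∑ x ∈ Finset.HasAntidiagonal.antidiagonal k,
              if x.2 = 0 then 0 else
            C (milnorGen K n (x.1 + 1) ^ (p ^ e) ^ x.2) * milnorGen (MvPolynomial ℕ K) n x.2 := by
          rw [← Finset.add_sum_erase _ _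
              (show (k, 0) ∈ Finset.HasAntidiagonal.antidiagonal k by simp),
            ← Finset.add_sum_erase (Finset.HasAntidiagonal.antidiagonal k) (fun x =>
              if x.2 = 0 then 0 else C (milnorGen K n (x.1 + 1) ^ (p ^ e) ^ x.2) *
                milnorGen (MvPolynomial ℕ K) n x.2)
              (show (k, 0) ∈ Finset.HasAntidiagonal.antidiagonal k by simp)]
          simp only [pow_zero, pow_one, milnorGen_zero, mul_one, if_true, zero_add]
          congr 1
          refine Finset.sum_congr rfl fun x hx => ?_
          rw [if_neg]
          intro h
          rw [Finset.mem_erase, Finset.HasAntidiagonal.mem_antidiagonal] at hx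
          apply hx.1
          ext <;> simp <;> lia
        rw [coprodGen, Finset.Nat.antidiagonal_succ, Finset.sum_cons, Finset.sum_map]
        simp only [Function.Embedding.prodMap, Function.Embedding.coeFn_mk, Prod.map,
          Nat.succ_eq_add_one, Function.Embedding.refl_apply]
        rw [h0]
        simp only [milnorGen_zero, one_pow, C_1, one_mul]
        ring
      rw [hs]
      refine Bounded.sum fun x hx => ?_
      rw [Finset.HasAntidiagonal.mem_antidiagonal] at hx
      split_ifs with h
      · exact Bounded.zero
      · refine bounded_coprod_term n _ _ _ ?_
        obtain ⟨b, hb⟩ := Nat.exists_eq_succ_of_ne_zero h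
        simp only [v]
        rw [hb, Nat.succ_eq_add_one, ← pow_mul, hg, hg']
        have := hw x.1 b
        rw [show x.1 + b + 1 = k by lia] at this
        lia
    refine ⟨?_, h1, h2⟩
    have := h1.add (h2.mono (d' := w k) (by lia))
    rwa [add_sub_cancel] at this
  have := Close.finsuppProd hv (fun k a => (hb k).pow_digitSum hv hv' a) T
  have h3 : (digitWeight p w T : ℤ) = T.sum fun k a => (w k * digitSum p a : ℤ) := by
    rw [digitWeight, Finsupp.sum, Finsupp.sum]
    push_cast
    rfl
  rw [h3]
  exact this

theorem bicoeff_monomial_mul (R S R' S' : ℕ →₀ ℕ) (c : K) (z : MvPolynomial ℕ (MvPolynomial ℕ K)) :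
    bicoeff R S (monomial S' (monomial R' c) * z) =
      if S' ≤ S ∧ R' ≤ R then c * bicoeff (R - R') (S - S') z else 0 := by
  classical
  rw [bicoeff, coeff_monomial_mul']
  by_cases hS : S' ≤ S
  · rw [if_pos hS, coeff_monomial_mul']
    by_cases hR : R' ≤ R
    · rw [if_pos hR, if_pos ⟨hS, hR⟩, bicoeff]
    · rw [if_neg hR, if_neg (fun h => hR h.2)]
  · rw [if_neg hS, if_neg (fun h => hS h.1), coeff_zero]

/-- The binomial theorem in each pair of variables; `R + S = T` because the factor of index `k` is
homogeneous of degree `T k`. -/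
theorem bicoeff_prod_add_pow (R S T : ℕ →₀ ℕ) :
    bicoeff R S (T.prod fun k a => (C (X k) + X k) ^ a : MvPolynomial ℕ (MvPolynomial ℕ K)) =
      if R + S = T then (T.prod fun k a => (a.choose (R k) : K)) else 0 := by
  classical
  induction T using Finsupp.induction generalizing R S with
  | zero =>
    have h1 : bicoeff R S (1 : MvPolynomial ℕ (MvPolynomial ℕ K)) = _ :=
      bicoeff_monomial R S 0 0 1
    rw [Finsupp.prod_zero_index, Finsupp.prod_zero_index, h1]
    have : (0 = S ∧ 0 = R) ↔ R + S = 0 := by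
      rw [add_eq_zero, and_comm, eq_comm, @eq_comm _ 0 S]
    simp only [this]
  | single_add k b T hk hb ih =>
    have hT : T k = 0 := Finsupp.notMem_support_iff.1 hk
    have hd : Disjoint (Finsupp.single k b).support T.support := by
      rw [Finsupp.support_single _ hb]
      simpa using hT
    have hs : ∀ {M : Type _} [CommMonoid M] (h : ℕ → ℕ → M),
        (Finsupp.single k b).prod h = h k b := fun h => by
      rw [Finsupp.prod, Finsupp.support_single _ hb, Finset.prod_singleton, Finsupp.single_eq_same]
    have hterm : ∀ m, ((C (X k) : MvPolynomial ℕ (MvPolynomial ℕ K)) ^ m * X k ^ (b - m) *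
        (b.choose m : MvPolynomial ℕ (MvPolynomial ℕ K))) =
        monomial (Finsupp.single k (b - m)) (monomial (Finsupp.single k m) (b.choose m : K)) := by
      intro m
      rw [← map_natCast (C : MvPolynomial ℕ K →+* MvPolynomial ℕ (MvPolynomial ℕ K)),
        ← map_natCast (C : K →+* MvPolynomial ℕ K), ← C_pow, mul_right_comm, ← C_mul,
        X_pow_eq_monomial, X_pow_eq_monomial, C_mul_monomial, mul_one, mul_comm, C_mul_monomial,
        mul_one]
    have hprod : ∀ m, (T.prod fun j a => (a.choose ((R - Finsupp.single k m : ℕ →₀ ℕ) j) : K)) =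
        T.prod fun j a => (a.choose (R j) : K) := by
      intro m
      refine Finsupp.prod_congr fun j hj => ?_
      have : k ≠ j := by rintro rfl; exact hk hj
      simp [this]
    rw [Finsupp.prod_add_index_of_disjoint hd, Finsupp.prod_add_index_of_disjoint hd, hs, hs,
      add_pow, Finset.sum_mul]
    simp only [hterm]
    have hsum : ∀ (s : Finset ℕ) (f : ℕ → MvPolynomial ℕ (MvPolynomial ℕ K)),
        bicoeff R S (∑ m ∈ s, f m) = ∑ m ∈ s, bicoeff R S (f m) := fun s f => by
      simp [bicoeff, coeff_sum]
    rw [hsum]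
    simp only [bicoeff_monomial_mul, ih, hprod]
    have hcond : ∀ m, m ≤ b → Finsupp.single k (b - m) ≤ S → Finsupp.single k m ≤ R →
        (R - Finsupp.single k m + (S - Finsupp.single k (b - m)) = T ↔
          R + S = Finsupp.single k b + T) := by
      intro m hm hS hR
      have e1 : R + S = Finsupp.single k b +
          (R - Finsupp.single k m + (S - Finsupp.single k (b - m))) := by
        conv_lhs => rw [← add_tsub_cancel_of_le hS, ← add_tsub_cancel_of_le hR]
        rw [← Nat.add_sub_of_le hm, Finsupp.single_add, Nat.add_sub_cancel_left]
        exact add_add_add_comm _ _ _ _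
      rw [e1, add_right_inj]
    by_cases h : R + S = Finsupp.single k b + T
    · have hkk : R k + S k = b := by
        have := DFunLike.congr_fun h k
        simpa [hT] using this
      rw [if_pos h, Finset.sum_eq_single (R k)]
      · have hS : Finsupp.single k (b - R k) ≤ S := Finsupp.single_le_iff.2 (by lia)
        have hR : Finsupp.single k (R k) ≤ R := Finsupp.single_le_iff.2 le_rfl
        rw [if_pos ⟨hS, hR⟩, if_pos ((hcond _ (by lia) hS hR).2 h)]
      · intro m hm hne
        rw [if_neg]
        rintro ⟨h1, h2⟩
        rw [Finsupp.single_le_iff] at h1 h2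
        exact hne (by lia)
      · intro h'
        exact absurd (Finset.mem_range.2 (by lia)) h'
    · rw [if_neg h]
      refine Finset.sum_eq_zero fun m hm => ?_
      have hm' := Finset.mem_range.1 hm
      split_ifs with h1 h2
      · exact absurd ((hcond m (by lia) h1.1 h1.2).1 h2) h
      · rw [mul_zero]
      · rfl

/-- The primitive parts only contribute to the coefficients of `s ^ R * t ^ S` with `R + S = T`. -/
theorem bicoeff_primMonomial {n : ℕ} {R S : ℕ →₀ ℕ} (hR : ∀ k ∈ R.support, k < n)
    (hS : ∀ k ∈ S.support, k < n) (T : ℕ →₀ ℕ) :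
    bicoeff R S (primMonomial K n T) =
      if R + S = T then (T.prod fun k a => (a.choose (R k) : K)) else 0 := by
  by_cases hT : ∀ k ∈ T.support, k < n
  · rw [← bicoeff_prod_add_pow]
    congr 1
    refine Finsupp.prod_congr fun k hk => ?_
    rw [milnorGen_succ _ (hT k hk), milnorGen_succ _ (hT k hk)]
  · push Not at hT
    obtain ⟨k, hk, hkn⟩ := hT
    rw [if_neg]
    · have : primMonomial K n T = 0 := by
        refine Finset.prod_eq_zero hk ?_
        simp only
        rw [milnorGen_of_lt _ (by lia), milnorGen_of_lt _ (by lia), C_0, add_zero,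
          zero_pow (Finsupp.mem_support_iff.1 hk)]
      rw [this]; simp [bicoeff]
    · rintro rfl
      classical
      rcases Finset.mem_union.1 (Finsupp.support_add hk) with h | h
      · exact absurd (hR k h) (by lia)
      · exact absurd (hS k h) (by lia)

/-! ### The leading term of the coproduct with respect to `s_1` -/

theorem genExp_apply (k i : ℕ) : genExp k i = if k = i + 1 then 1 else 0 := by
  cases k with
  | zero => simp [genExp]
  | succ k => simp [genExp, Finsupp.single_apply]

theorem sum_smul_genExp (T : ℕ →₀ ℕ) : (T.sum fun k a => a • genExp k) = shiftExp T := by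
  ext i
  rw [Finsupp.sum_apply, shiftExp_apply, Finsupp.sum]
  simp only [Finsupp.smul_apply, genExp_apply, smul_eq_mul, mul_ite, mul_one, mul_zero]
  rw [Finset.sum_ite_eq']
  split_ifs with h
  · rfl
  · exact (Finsupp.notMem_support_iff.1 h).symm

/-- Monomials are filtered by the exponent of `s_1` alone. In the coproduct of `ξ_(k+1)` the only
term that involves `s_1` is `s_1^(q^k) t_k`, so the leading term for `ξ^T` is the product of these.
-/
theorem close_leading {q : ℕ} (hq : 0 < q) (n : ℕ) (T : ℕ →₀ ℕ) :
    Close (fun R _ => (R 0 : ℕ)) 1 (leadExp q T) (coprodMonomial K q n T)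
      (T.prod fun k a => (C (milnorGen K n 1 ^ q ^ k) * milnorGen (MvPolynomial ℕ K) n k) ^ a) := by
  set v : (ℕ →₀ ℕ) → (ℕ →₀ ℕ) → ℤ := fun R _ => (R 0 : ℕ)
  have hv : IsSubadd v := ⟨by simp [v], fun R R' S S' => by simp [v]⟩
  have hb : ∀ k, Close v 1 (q ^ k : ℕ) (coprodGen K q n (k + 1))
      (C (milnorGen K n 1 ^ q ^ k) * milnorGen (MvPolynomial ℕ K) n k) := by
    intro k
    have h1 : Bounded v (q ^ k : ℕ)
        (C (milnorGen K n 1 ^ q ^ k) * milnorGen (MvPolynomial ℕ K) n k) := by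
      refine bounded_coprod_term n _ _ _ ?_
      simp [v, genExp]
    have h2 : Bounded v ((q ^ k : ℕ) - 1 : ℤ) (coprodGen K q n (k + 1) -
        C (milnorGen K n 1 ^ q ^ k) * milnorGen (MvPolynomial ℕ K) n k) := by
      rw [coprodGen, ← Finset.add_sum_erase _ _
        (show (1, k) ∈ Finset.HasAntidiagonal.antidiagonal (k + 1) by simp [add_comm]),
        add_sub_cancel_left]
      refine Bounded.sum fun x hx => bounded_coprod_term n _ _ _ ?_
      rw [Finset.mem_erase, Finset.HasAntidiagonal.mem_antidiagonal] at hx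
      have hx1 : x.1 ≠ 1 := by
        intro h
        apply hx.1
        ext <;> simp <;> lia
      have : 1 ≤ q ^ k := Nat.one_le_pow _ _ hq
      simp only [v, Finsupp.smul_apply, genExp_apply, zero_add, if_neg hx1, smul_zero]
      push_cast
      zify at this
      lia
    refine ⟨?_, h1, h2⟩
    have := h1.add (h2.mono (d' := (q ^ k : ℕ)) (by lia))
    rwa [add_sub_cancel] at this
  have := Close.finsuppProd hv (fun k a => (hb k).pow hv a) T
  have h3 : (leadExp q T : ℤ) = T.sum fun k a => ((q ^ k : ℕ) * a : ℤ) := by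
    rw [leadExp, Finsupp.weight_apply, Finsupp.sum, Finsupp.sum]
    push_cast
    refine Finset.sum_congr rfl fun k _ => ?_
    rw [smul_eq_mul]; push_cast; ring
  rw [h3]
  exact this

theorem le_leadExp_of_bicoeff_ne_zero {q : ℕ} (hq : 0 < q) {n a : ℕ} {S T : ℕ →₀ ℕ}
    (h : bicoeff (Finsupp.single 0 a) S (coprodMonomial K q n T) ≠ 0) : a ≤ leadExp q T := by
  have := (close_leading hq n T).1 _ _ h
  simpa using this

theorem bicoeff_leadExp {q : ℕ} (hq : 0 < q) {n : ℕ} (hn : 1 ≤ n) {S : ℕ →₀ ℕ}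
    (hS : ∀ k ∈ S.support, k < n) (T : ℕ →₀ ℕ) :
    bicoeff (Finsupp.single 0 (leadExp q T)) S (coprodMonomial K q n T) =
      if S = shiftExp T then 1 else 0 := by
  have h1 : bicoeff (Finsupp.single 0 (leadExp q T)) S (coprodMonomial K q n T) =
      bicoeff (Finsupp.single 0 (leadExp q T)) S (T.prod fun k a =>
        (C (milnorGen K n 1 ^ q ^ k) * milnorGen (MvPolynomial ℕ K) n k) ^ a) := by
    rw [← sub_eq_zero, ← bicoeff_sub]
    by_contra h
    have := (close_leading hq n T).2.2 _ _ h
    simp at this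
  rw [h1]
  by_cases hT : ∀ k ∈ T.support, k ≤ n
  · have h2 : (T.prod fun k a =>
        (C (milnorGen K n 1 ^ q ^ k) * milnorGen (MvPolynomial ℕ K) n k) ^ a) =
        monomial (shiftExp T) (monomial (Finsupp.single 0 (leadExp q T)) (1 : K)) := by
      have h3 : ∀ k ∈ T.support,
          (C (milnorGen K n 1 ^ q ^ k) * milnorGen (MvPolynomial ℕ K) n k) ^ T k =
          monomial (T k • genExp k) 1 * C (monomial (T k • q ^ k • Finsupp.single 0 1) (1 : K)) := by
        intro k hk
        rw [milnorGen, milnorGen, if_pos hn, if_pos (hT k hk), mul_pow, ← C_pow, monomial_pow,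
          monomial_pow, monomial_pow, one_pow, one_pow, one_pow, mul_comm, genExp_succ]
      rw [Finsupp.prod, Finset.prod_congr rfl h3, Finset.prod_mul_distrib, ← map_prod,
        ← monomial_sum_one, ← monomial_sum_one, mul_comm, C_mul_monomial, mul_one]
      congr 2
      · exact sum_smul_genExp T
      · congr 1
        rw [leadExp, Finsupp.weight_apply, Finsupp.sum]
        simp only [Finsupp.smul_single, smul_eq_mul, mul_one]
        exact (map_sum (Finsupp.singleAddHom 0) _ _).symm
    rw [h2, bicoeff_monomial]
    simp [eq_comm]
  -- An index `k > n` in `T` makes the truncated product vanish. It also puts `k - 1 ≥ n` in the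
  -- support of `shiftExp T`, which therefore differs from `S`.
  · push Not at hT
    obtain ⟨k, hk, hkn⟩ := hT
    have h0 : (T.prod fun k a =>
        (C (milnorGen K n 1 ^ q ^ k) * milnorGen (MvPolynomial ℕ K) n k) ^ a) = 0 := by
      refine Finset.prod_eq_zero hk ?_
      simp only
      rw [milnorGen_of_lt _ hkn, mul_zero, zero_pow (Finsupp.mem_support_iff.1 hk)]
    rw [h0, if_neg]
    · simp [bicoeff]
    · rintro rfl
      have h4 : k - 1 ∈ (shiftExp T).support := by
        rw [Finsupp.mem_support_iff, shiftExp_apply, show k - 1 + 1 = k by lia]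
        exact Finsupp.mem_support_iff.1 hk
      have := hS _ h4
      lia

end

/-! ### Milnor operations indexed by finitely supported sequences -/

section
open MvPolynomial
variable (F : Type*) [Field F] (q : ℕ)

/-- The total Milnor operation truncated at `n`, with the variables `t_i` indexed by all natural
numbers. -/
noncomputable def totalOp (n : ℕ) :
    MvPolynomial ℕ F →ₐ[F] MvPolynomial ℕ (MvPolynomial ℕ F) :=
  aeval fun j => ∑ i ∈ Finset.range (n + 1), milnorGen (MvPolynomial ℕ F) n i * C (X j ^ q ^ i)

theorem totalOp_X (n j : ℕ) : totalOp F q n (X j) =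
    ∑ i ∈ Finset.range (n + 1), milnorGen (MvPolynomial ℕ F) n i * C (X j ^ q ^ i) :=
  aeval_X _ _

/-- Setting `t_i = 0` for `i > ℓ` shows that the truncation does not matter: `P(R)` can be read off
from any sufficiently long total operation. -/
theorem killCompl_totalOp {ℓ n : ℕ} (h : ℓ ≤ n) :
    ((killCompl (Fin.val_injective (n := ℓ))).restrictScalars F).comp (totalOp F q n) =
      milnorTotal F q ℓ := by
  apply algHom_ext
  intro j
  have hC : ∀ x : MvPolynomial ℕ F, killCompl (Fin.val_injective (n := ℓ)) (C x) = C x :=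
    fun x => (killCompl _).commutes x
  rw [AlgHom.comp_apply, totalOp_X, milnorTotal_X, Finset.sum_range_succ']
  simp only [AlgHom.restrictScalars_apply, map_add, map_sum, map_mul, hC]
  rw [add_comm, milnorGen_zero, map_one, one_mul, pow_zero, pow_one]
  congr 1
  rw [← Finset.sum_subset (Finset.range_mono h), Finset.sum_range]
  · refine Finset.sum_congr rfl fun i _ => ?_
    have h1 : killCompl (Fin.val_injective (n := ℓ)) (X i.val) =
        (X i : MvPolynomial (Fin ℓ) (MvPolynomial ℕ F)) := by
      rw [← rename_X Fin.val i, killCompl_rename_app]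
    rw [milnorGen_succ _ (by have := i.isLt; lia), h1]
  · intro i hi hi'
    rw [Finset.mem_range] at hi hi'
    rw [milnorGen_succ _ hi, killCompl, aeval_X, dif_neg, zero_mul]
    rintro ⟨i', rfl⟩
    exact hi' i'.isLt

theorem coeff_totalOp {ℓ n : ℕ} (h : ℓ ≤ n) (R : Fin ℓ → ℕ) (f : MvPolynomial ℕ F) :
    (totalOp F q n f).coeff ((Finsupp.equivFunOnFinite.symm R).mapDomain Fin.val) =
      milnorOp F q R f := by
  rw [milnorOp_apply, ← killCompl_totalOp F q h, AlgHom.comp_apply, AlgHom.restrictScalars_apply,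
    coeff_killCompl']

/-- The Milnor operation `P(T)` for a finitely supported sequence `T`, with `r_i` at index
`i - 1`. -/
noncomputable def seqOp (T : ℕ →₀ ℕ) : Module.End F (MvPolynomial ℕ F) :=
  milnorOp F q fun i : Fin (T.support.sup Nat.succ) => T i

theorem mapDomain_val_restrict {T : ℕ →₀ ℕ} {ℓ : ℕ} (h : ∀ k ∈ T.support, k < ℓ) :
    (Finsupp.equivFunOnFinite.symm fun i : Fin ℓ => T i).mapDomain Fin.val = T := by
  ext k
  by_cases hk : k < ℓ
  · have := Finsupp.mapDomain_apply (Fin.val_injective (n := ℓ))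
      (Finsupp.equivFunOnFinite.symm fun i : Fin ℓ => T i) ⟨k, hk⟩
    exact this
  · rw [Finsupp.mapDomain_of_notMem_range]
    · exact (Finsupp.notMem_support_iff.1 fun h' => hk (h k h')).symm
    · rintro ⟨i, rfl⟩
      exact hk i.isLt

theorem coeff_totalOp_eq_seqOp {T : ℕ →₀ ℕ} {n : ℕ} (h : ∀ k ∈ T.support, k < n)
    (f : MvPolynomial ℕ F) : (totalOp F q n f).coeff T = seqOp F q T f := by
  have h1 : ∀ k ∈ T.support, k < T.support.sup Nat.succ := fun k hk =>
    Finset.le_sup (f := Nat.succ) hk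
  have h2 : T.support.sup Nat.succ ≤ n := Finset.sup_le fun k hk => h k hk
  rw [seqOp, ← coeff_totalOp F q h2, mapDomain_val_restrict h1]

theorem milnorOp_eq_seqOp {ℓ : ℕ} (R : Fin ℓ → ℕ) :
    milnorOp F q R = seqOp F q ((Finsupp.equivFunOnFinite.symm R).mapDomain Fin.val) := by
  classical
  refine LinearMap.ext fun f => ?_
  rw [← coeff_totalOp F q le_rfl, coeff_totalOp_eq_seqOp]
  intro k hk
  obtain ⟨i, _, rfl⟩ := Finset.mem_image.1 (Finsupp.mapDomain_support hk)
  exact i.isLt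

theorem steenrodOp_eq_seqOp (r : ℕ) : steenrodOp F q r = seqOp F q (Finsupp.single 0 r) := by
  rw [steenrodOp, milnorOp_eq_seqOp, symm_fin_one, Finsupp.mapDomain_single]
  rfl

theorem seqOp_zero : seqOp F q 0 = 1 := by
  have : (fun i : Fin ((0 : ℕ →₀ ℕ).support.sup Nat.succ) => (0 : ℕ →₀ ℕ) i) = 0 := rfl
  rw [seqOp, this, milnorOp_zero]

theorem seqOp_apply_one {T : ℕ →₀ ℕ} (hT : T ≠ 0) : seqOp F q T 1 = 0 := by
  classical
  rw [← coeff_totalOp_eq_seqOp F q (n := T.support.sup Nat.succ)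
    (fun k hk => Finset.le_sup (f := Nat.succ) hk), map_one, coeff_one, if_neg hT.symm]

/-! ### The product formula -/

/-- Substituting one total operation in another gives `∑_b t_b (∑_a s_a x^(q^a))^(q^b)`. By
additivity of Frobenius this is `∑_k (∑_(a+b=k) s_a^(q^b) t_b) x^(q^k)`, the total operation
evaluated at the coproducts. The indices `a + b` go up to `2 * n`, hence the condition on `N`. -/
theorem map_comp_totalOp {p e : ℕ} [Fact p.Prime] [CharP F p] {n N : ℕ} (hN : 2 * n ≤ N) :
    (map (totalOp F (p ^ e) n : MvPolynomial ℕ F →+* MvPolynomial ℕ (MvPolynomial ℕ F))).comp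
      (totalOp F (p ^ e) n : MvPolynomial ℕ F →+* MvPolynomial ℕ (MvPolynomial ℕ F)) =
    (eval₂Hom ((C : MvPolynomial ℕ (MvPolynomial ℕ F) →+* _).comp C)
        (fun k => coprodGen (MvPolynomial ℕ F) (p ^ e) n (k + 1))).comp
      (totalOp F (p ^ e) N : MvPolynomial ℕ F →+* MvPolynomial ℕ (MvPolynomial ℕ F)) := by
  set g : MvPolynomial ℕ (MvPolynomial ℕ F) →+* MvPolynomial ℕ (MvPolynomial ℕ (MvPolynomial ℕ F)) :=
    eval₂Hom ((C : MvPolynomial ℕ (MvPolynomial ℕ F) →+* _).comp C) (fun k => coprodGen (MvPolynomial ℕ F) (p ^ e) n (k + 1))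
  apply ringHom_ext
  · intro c
    have h1 : ∀ m, (totalOp F (p ^ e) m : (MvPolynomial ℕ F) →+* MvPolynomial ℕ (MvPolynomial ℕ F)) (C c) = C (C c) := fun m =>
      (totalOp F (p ^ e) m).commutes c
    simp only [RingHom.comp_apply, h1, map_C]
    simp [g]
  · intro j
    simp only [RingHom.comp_apply, RingHom.coe_coe]
    have hgen : ∀ k ≤ N, g (milnorGen (MvPolynomial ℕ F) N k) = coprodGen (MvPolynomial ℕ F) (p ^ e) n k := by
      intro k hk
      cases k with
      | zero => rw [milnorGen_zero, map_one, coprodGen_zero]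
      | succ k =>
        rw [milnorGen_succ _ hk]
        simp [g]
    have hC : ∀ x, g (C x) = C (C x) := fun x => by simp [g]
    have hL : map (totalOp F (p ^ e) n : (MvPolynomial ℕ F) →+* MvPolynomial ℕ (MvPolynomial ℕ F)) (totalOp F (p ^ e) n (X j)) =
        ∑ x ∈ Finset.range (n + 1) ×ˢ Finset.range (n + 1),
          C (milnorGen (MvPolynomial ℕ F) n x.1 ^ (p ^ e) ^ x.2) * milnorGen (MvPolynomial ℕ (MvPolynomial ℕ F)) n x.2 *
            C (C (X j ^ (p ^ e) ^ (x.1 + x.2))) := by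
      rw [totalOp_X, map_sum, Finset.sum_product_right]
      refine Finset.sum_congr rfl fun b _ => ?_
      rw [map_mul, map_milnorGen, map_C, RingHom.coe_coe, map_pow, totalOp_X, ← pow_mul,
        sum_pow_char_pow, map_sum, Finset.mul_sum]
      refine Finset.sum_congr rfl fun a _ => ?_
      rw [mul_pow, ← C_pow, ← pow_mul, ← pow_mul, ← pow_mul, ← pow_add, ← mul_add, C_mul,
        mul_left_comm, mul_assoc, ← pow_mul]
    rw [hL, totalOp_X, map_sum]
    rw [← Finset.sum_fiberwise_of_maps_to (t := Finset.range (N + 1)) (g := fun x => x.1 + x.2)]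
    · refine Finset.sum_congr rfl fun k hk => ?_
      have hk' : k ≤ N := by have := Finset.mem_range.1 hk; lia
      rw [map_mul, hgen k hk', hC, coprodGen, Finset.sum_mul]
      refine (Finset.sum_congr rfl fun x hx => ?_).trans (Finset.sum_subset
        (s₁ := {x ∈ Finset.range (n + 1) ×ˢ Finset.range (n + 1) | x.1 + x.2 = k})
        (f := fun x => C (milnorGen (MvPolynomial ℕ F) n x.1 ^ (p ^ e) ^ x.2) *
          milnorGen (MvPolynomial ℕ (MvPolynomial ℕ F)) n x.2 * C (C (X j ^ (p ^ e) ^ k))) ?_ ?_)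
      · rw [(Finset.mem_filter.1 hx).2]
      · intro x hx
        exact Finset.HasAntidiagonal.mem_antidiagonal.2 (Finset.mem_filter.1 hx).2
      · intro x hx hx'
        rw [Finset.HasAntidiagonal.mem_antidiagonal] at hx
        have : n < x.1 ∨ n < x.2 := by
          by_contra! h
          refine hx' (Finset.mem_filter.2 ⟨Finset.mem_product.2 ⟨?_, ?_⟩, hx⟩) <;>
            rw [Finset.mem_range] <;> lia
        have hq : (p ^ e) ^ x.2 ≠ 0 := pow_ne_zero _ (pow_ne_zero _ (Fact.out : p.Prime).ne_zero)
        rcases this with h | h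
        · rw [milnorGen_of_lt _ h, zero_pow hq]; simp
        · rw [milnorGen_of_lt _ h]; simp
    · intro x hx
      have := Finset.mem_product.1 hx
      rw [Finset.mem_range, Finset.mem_range] at this
      rw [Finset.mem_range]
      lia

/-- The product of two Milnor operations: the coefficients are those of the coproduct. -/
theorem seqOp_mul_seqOp {p e : ℕ} [Fact p.Prime] [CharP F p] {n : ℕ} {R S : ℕ →₀ ℕ}
    (hR : ∀ k ∈ R.support, k < n) (hS : ∀ k ∈ S.support, k < n) {s : Finset (ℕ →₀ ℕ)}
    (hs : ∀ T, bicoeff R S (coprodMonomial F (p ^ e) n T) ≠ 0 → T ∈ s) :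
    seqOp F (p ^ e) R * seqOp F (p ^ e) S =
      ∑ T ∈ s, bicoeff R S (coprodMonomial F (p ^ e) n T) • seqOp F (p ^ e) T := by
  classical
  refine LinearMap.ext fun f => ?_
  set N := max (2 * n) (s.sup fun T => T.support.sup Nat.succ)
  have hN : ∀ T ∈ s, ∀ k ∈ T.support, k < N := fun T hT k hk =>
    lt_of_lt_of_le (Finset.le_sup (f := Nat.succ) hk) ((Finset.le_sup
      (f := fun T : ℕ →₀ ℕ => T.support.sup Nat.succ) hT).trans (le_max_right _ _))
  have hL : (seqOp F (p ^ e) R * seqOp F (p ^ e) S) f = bicoeff R S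
      (map (totalOp F (p ^ e) n : MvPolynomial ℕ F →+* _) (totalOp F (p ^ e) n f)) := by
    rw [bicoeff, coeff_map, coeff_totalOp_eq_seqOp F _ hS, RingHom.coe_coe,
      coeff_totalOp_eq_seqOp F _ hR, Module.End.mul_apply]
  have hcomp := RingHom.congr_fun (map_comp_totalOp F (e := e) (p := p)
    (show 2 * n ≤ N from le_max_left _ _)) f
  rw [RingHom.comp_apply, RingHom.comp_apply, RingHom.coe_coe, RingHom.coe_coe] at hcomp
  rw [hL, hcomp, LinearMap.sum_apply]
  have hG : ∀ g : MvPolynomial ℕ (MvPolynomial ℕ F), bicoeff R S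
      (eval₂Hom ((C : MvPolynomial ℕ (MvPolynomial ℕ F) →+* _).comp C)
        (fun k => coprodGen (MvPolynomial ℕ F) (p ^ e) n (k + 1)) g) =
      ∑ T ∈ s, bicoeff R S (coprodMonomial F (p ^ e) n T) • g.coeff T := by
    intro g
    induction g using MvPolynomial.induction_on' with
    | monomial U c =>
      -- The coproduct is base changed from `F` to `F[x]`, so the structure constants lie in `F`.
      have h1 : eval₂Hom ((C : MvPolynomial ℕ (MvPolynomial ℕ F) →+* _).comp C)
          (fun k => coprodGen (MvPolynomial ℕ F) (p ^ e) n (k + 1)) (monomial U c) =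
          C (C c) * map (map C) (coprodMonomial F (p ^ e) n U) := by
        rw [coe_eval₂Hom, eval₂_monomial, map_coprodMonomial]
        rfl
      have h2 : bicoeff R S (C (C c) * map (map C) (coprodMonomial F (p ^ e) n U)) =
          bicoeff R S (coprodMonomial F (p ^ e) n U) • c := by
        rw [bicoeff, coeff_C_mul, coeff_C_mul, coeff_map, coeff_map, ← bicoeff, smul_eq_C_mul,
          mul_comm]
      rw [h1, h2]
      simp only [coeff_monomial]
      by_cases hU : U ∈ s
      · rw [Finset.sum_eq_single U]
        · rw [if_pos rfl]
        · intro T _ hT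
          rw [if_neg hT.symm, smul_zero]
        · exact fun h => absurd hU h
      · rw [Finset.sum_eq_zero]
        · by_contra h
          exact hU (hs U fun h0 => h (by rw [h0, zero_smul]))
        · intro T hT
          rw [if_neg (by rintro rfl; exact hU hT), smul_zero]
    | add x y hx hy =>
      rw [map_add, bicoeff_add, hx, hy, ← Finset.sum_add_distrib]
      simp only [coeff_add, smul_add]
  rw [hG]
  refine Finset.sum_congr rfl fun T hT => ?_
  rw [coeff_totalOp_eq_seqOp F _ (hN T hT)]
  rfl

end

/-! ### Linear independence of the Milnor operations -/

section
open MvPolynomial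
variable (F : Type*) [Field F]

/-- Lists the generators in `ξ^T` with multiplicity; in the detection of `P(T)` each of them gets
its own variable `x_j`. -/
theorem exists_sum_single_eq (T : ℕ →₀ ℕ) :
    ∃ (N : ℕ) (φ : Fin N → ℕ), ∑ j, Finsupp.single (φ j) 1 = T := by
  induction T using Finsupp.induction_linear with
  | zero => exact ⟨0, Fin.elim0, by simp⟩
  | add R S hR hS =>
    obtain ⟨N, φ, rfl⟩ := hR
    obtain ⟨M, ψ, rfl⟩ := hS
    exact ⟨N + M, Fin.append φ ψ, by rw [Fin.sum_univ_add]; simp⟩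
  | single k a =>
    exact ⟨a, fun _ => k, by simp⟩

/-- A coefficient of a polynomial operation that detects the Milnor operation `P(T₀)`. -/
theorem exists_coeff_seqOp {q : ℕ} (hq : 1 < q) (T₀ : ℕ →₀ ℕ) :
    ∃ (f : MvPolynomial ℕ F) (m : ℕ →₀ ℕ), ∀ T,
      (seqOp F q T f).coeff m = if T = T₀ then 1 else 0 := by
  classical
  obtain ⟨N, φ₀, hφ₀⟩ := exists_sum_single_eq T₀
  let ex : (Fin N → ℕ) → (ℕ →₀ ℕ) := fun φ => ∑ j : Fin N, Finsupp.single j.val (q ^ φ j)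
  have hex : ∀ φ j, ex φ (j : Fin N).val = q ^ φ j := by
    intro φ j
    simp only [ex, Finsupp.finsetSum_apply, Finsupp.single_apply, Fin.val_inj]
    simp
  have hinj : Function.Injective ex := by
    intro φ ψ h
    funext j
    have := DFunLike.congr_fun h j.val
    rw [hex, hex] at this
    exact Nat.pow_right_injective hq this
  -- On `x_0 ⋯ x_(N-1)` the total operation is a sum over `φ` of `∏ t_(φ j) x_j^(q^(φ j))`. The
  -- exponents of the `x_j` determine `φ`, so one coefficient isolates one sequence; `+ 1` turns the
  -- index `φ₀ j` into the number of a Milnor generator.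
  refine ⟨∏ j : Fin N, X j.val, ex fun j => φ₀ j + 1, fun T => ?_⟩
  set n := max (T.support.sup Nat.succ) (T₀.support.sup Nat.succ)
  have hT : ∀ k ∈ T.support, k < n := fun k hk =>
    lt_of_lt_of_le (Finset.le_sup (f := Nat.succ) hk) (le_max_left _ _)
  have hT₀ : ∀ k ∈ T₀.support, k < n := fun k hk =>
    lt_of_lt_of_le (Finset.le_sup (f := Nat.succ) hk) (le_max_right _ _)
  have hmem : (fun j => φ₀ j + 1) ∈ Fintype.piFinset fun _ : Fin N => Finset.range (n + 1) := by
    refine Fintype.mem_piFinset.2 fun j => ?_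
    have : φ₀ j ∈ T₀.support := by
      rw [Finsupp.mem_support_iff, ← hφ₀, Finsupp.finsetSum_apply]
      refine (Finset.sum_pos' (fun _ _ => Nat.zero_le _) ⟨j, Finset.mem_univ j, ?_⟩).ne'
      simp
    have := hT₀ _ this
    rw [Finset.mem_range]
    lia
  have hterm : ∀ φ ∈ Fintype.piFinset fun _ : Fin N => Finset.range (n + 1),
      ∏ j : Fin N, milnorGen (MvPolynomial ℕ F) n (φ j) * C (X j.val ^ q ^ φ j) =
        monomial (∑ j, genExp (φ j)) (monomial (ex φ) 1) := by
    intro φ hφ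
    have h1 : ∀ j, milnorGen (MvPolynomial ℕ F) n (φ j) = monomial (genExp (φ j)) 1 := by
      intro j
      have := Fintype.mem_piFinset.1 hφ j
      rw [Finset.mem_range] at this
      rw [milnorGen, if_pos (by lia)]
    simp only [h1]
    rw [Finset.prod_mul_distrib, ← monomial_sum_one, ← map_prod]
    simp only [X_pow_eq_monomial]
    rw [← monomial_sum_one, mul_comm, C_mul_monomial, mul_one]
  rw [← coeff_totalOp_eq_seqOp F q hT, map_prod]
  simp only [totalOp_X]
  rw [Finset.prod_univ_sum, Finset.sum_congr rfl hterm, coeff_sum, coeff_sum]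
  have hb : ∀ φ : Fin N → ℕ, coeff (ex fun j => φ₀ j + 1)
      (coeff T (monomial (∑ j, genExp (φ j)) (monomial (ex φ) (1 : F)))) =
        if ∑ j, genExp (φ j) = T ∧ ex φ = ex (fun j => φ₀ j + 1) then 1 else 0 :=
    fun φ => bicoeff_monomial _ _ _ _ _
  simp only [hb, hinj.eq_iff]
  rw [Finset.sum_eq_single fun j => φ₀ j + 1]
  · simp only [genExp_succ, hφ₀, and_true, eq_comm]
  · intro φ _ hφ
    rw [if_neg fun h => hφ h.2]
  · exact fun h => absurd hmem h

theorem linearIndependent_seqOp {q : ℕ} (hq : 1 < q) : LinearIndependent F (seqOp F q) := by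
  rw [linearIndependent_iff]
  intro g hg
  ext T₀
  obtain ⟨f, m, h⟩ := exists_coeff_seqOp F hq T₀
  have h1 := congrArg (fun x : Module.End F (MvPolynomial ℕ F) => (x f).coeff m) hg
  simp only [Finsupp.linearCombination_apply, Finsupp.sum, LinearMap.sum_apply,
    LinearMap.smul_apply, coeff_sum, coeff_smul, h, LinearMap.zero_apply, coeff_zero,
    smul_eq_mul, mul_ite, mul_one, mul_zero] at h1
  rw [Finset.sum_ite_eq'] at h1
  rw [Finsupp.zero_apply]
  split_ifs at h1 with h2
  · exact h1
  · exact Finsupp.notMem_support_iff.1 h2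

/-! ### Structure constants -/

/-- The coefficients of a product of two Milnor operations. -/
theorem exists_seqOp_mul {p e : ℕ} (hp : p.Prime) (he : e ≠ 0) [CharP F p] (R S : ℕ →₀ ℕ) :
    ∃ c : (ℕ →₀ ℕ) →₀ F,
      seqOp F (p ^ e) R * seqOp F (p ^ e) S = Finsupp.linearCombination F (seqOp F (p ^ e)) c ∧
      (∀ T, c T ≠ 0 → milnorDegree (p ^ e) T = milnorDegree (p ^ e) R + milnorDegree (p ^ e) S) ∧
      (∀ T, c T ≠ 0 → S.degree ≤ T.degree) ∧
      (∀ w : ℕ → ℕ, (∀ i j, w i + w j ≤ w (i + j + 1)) → ∀ T, c T ≠ 0 →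
        digitWeight p w R + digitWeight p w S ≤ digitWeight p w T) ∧
      (∀ w : ℕ → ℕ, (∀ i j, w i + w j + 1 ≤ w (i + j + 1)) → ∀ T, T ≠ R + S → c T ≠ 0 →
        digitWeight p w R + digitWeight p w S < digitWeight p w T) ∧
      c (R + S) = ((R + S).prod fun k a => (a.choose (R k) : F)) ∧
      (∀ a T, R = Finsupp.single 0 a → c T ≠ 0 → a ≤ leadExp (p ^ e) T) ∧
      (∀ T, R = Finsupp.single 0 (leadExp (p ^ e) T) →
        c T = if S = shiftExp T then 1 else 0) := by
  classical
  have : Fact p.Prime := ⟨hp⟩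
  have hq : 1 < p ^ e := Nat.one_lt_pow he hp.one_lt
  -- The leading term involves `ξ_1`, so the truncation must retain it.
  set n := max 1 (max (R.support.sup Nat.succ) (S.support.sup Nat.succ))
  have hR : ∀ k ∈ R.support, k < n := fun k hk =>
    lt_of_lt_of_le (Finset.le_sup (f := Nat.succ) hk)
      ((le_max_left _ _).trans (le_max_right _ _))
  have hS : ∀ k ∈ S.support, k < n := fun k hk =>
    lt_of_lt_of_le (Finset.le_sup (f := Nat.succ) hk)
      ((le_max_right _ _).trans (le_max_right _ _))
  have hfin : {T | bicoeff R S (coprodMonomial F (p ^ e) n T) ≠ 0}.Finite :=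
    (finite_milnorDegree_le hq (milnorDegree (p ^ e) R + milnorDegree (p ^ e) S)).subset
      fun T hT => (milnorDegree_of_bicoeff_ne_zero (by lia) hT).le
  let c : (ℕ →₀ ℕ) →₀ F := Finsupp.onFinset hfin.toFinset
    (fun T => bicoeff R S (coprodMonomial F (p ^ e) n T)) fun T hT => by simpa using hT
  have hc : ∀ T, c T = bicoeff R S (coprodMonomial F (p ^ e) n T) := fun T => rfl
  have hprim : ∀ T, T ≠ R + S → bicoeff R S (primMonomial F n T) = 0 := fun T hT => by
    rw [bicoeff_primMonomial hR hS, if_neg hT.symm]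
  refine ⟨c, ?_, ?_, ?_, ?_, ?_, ?_, ?_, ?_⟩
  · rw [seqOp_mul_seqOp F hR hS (s := hfin.toFinset) (by simp),
      Finsupp.linearCombination_apply, Finsupp.onFinset_sum]
    simp
  · exact fun T hT => milnorDegree_of_bicoeff_ne_zero (by lia) hT
  · exact fun T hT => degree_le_of_bicoeff_ne_zero hT
  · intro w hw T hT
    have := (close_coprodMonomial (K := F) (p := p) e n 0 (w := w) hw T).1 R S hT
    push_cast at this
    lia
  · intro w hw T hne hT
    have := (close_coprodMonomial (K := F) (p := p) e n 1 (w := w) hw T).2.2 R S (by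
      rw [bicoeff_sub, hprim T hne, sub_zero]
      exact hT)
    push_cast at this
    lia
  -- A contribution of mixed terms at `T = R + S` would make the weight of `R + S` exceed the sum of
  -- the two weights, against subadditivity. Any strictly superadditive weight serves here.
  · have h1 : bicoeff R S (coprodMonomial F (p ^ e) n (R + S) - primMonomial F n (R + S)) = 0 := by
      by_contra h
      have := (close_coprodMonomial (K := F) (p := p) e n 1 (w := fun i => 2 * i + 1)
        (by intros; lia) (R + S)).2.2 R S h
      have h2 := digitWeight_add_le (p := p) (fun i => 2 * i + 1) hp R S
      push_cast at this
      lia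
    rw [hc]
    rw [bicoeff_sub, sub_eq_zero, bicoeff_primMonomial hR hS, if_pos rfl] at h1
    exact h1
  · rintro a T rfl hT
    exact le_leadExp_of_bicoeff_ne_zero (by lia) hT
  · intro T hT
    exact (congrArg (fun x => bicoeff x S (coprodMonomial F (p ^ e) n T)) hT).trans
      (bicoeff_leadExp (by lia) (le_max_left _ _) hS T)

end

/-! ### Generation of the Milnor operations by Steenrod powers -/

section
open MvPolynomial
variable {F : Type*} [Field F] {p e : ℕ}

theorem digitWeight_add_weight (w w' : ℕ → ℕ) (T : ℕ →₀ ℕ) :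
    digitWeight p (fun k => w k + w' k) T = digitWeight p w T + digitWeight p w' T := by
  simp only [digitWeight, add_mul, Finsupp.sum_add]

/-- Bounds the strict weight in a given degree, so that the downward induction in
`seqOp_mem_filtration` ends. -/
theorem digitWeight_le_milnorDegree {q : ℕ} (hq : 1 < q) (T : ℕ →₀ ℕ) :
    digitWeight p (fun k => 3 * k + 2) T ≤ 3 * milnorDegree q T := by
  rw [milnorDegree, Finsupp.weight_apply, digitWeight, Finsupp.sum, Finsupp.sum, Finset.mul_sum]
  refine Finset.sum_le_sum fun k _ => ?_
  have h2 : k + 1 ≤ q ^ (k + 1) - 1 := by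
    have := Nat.lt_pow_self hq (n := k + 1)
    lia
  calc (3 * k + 2) * digitSum p (T k) ≤ (3 * (q ^ (k + 1) - 1)) * T k :=
        Nat.mul_le_mul (by lia) (digitSum_le p _)
    _ = 3 * (T k • (q ^ (k + 1) - 1)) := by rw [smul_eq_mul]; ring

/-- Solves an expansion for one of its Milnor operations. -/
theorem seqOp_mem_of_linearCombination_mem {q m : ℕ}
    {J : ℕ → Submodule F (Module.End F (MvPolynomial ℕ F))} {c : (ℕ →₀ ℕ) →₀ F} {T : ℕ →₀ ℕ}
    (h : Finsupp.linearCombination F (seqOp F q) c ∈ J m) (hT : c T ≠ 0)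
    (h' : ∀ T', T' ≠ T → c T' ≠ 0 → seqOp F q T' ∈ J m) : seqOp F q T ∈ J m := by
  classical
  rw [Finsupp.linearCombination_apply, Finsupp.sum,
    ← Finset.add_sum_erase _ _ (Finsupp.mem_support_iff.2 hT)] at h
  have h1 : ∑ T' ∈ c.support.erase T, c T' • seqOp F q T' ∈ J m :=
    Submodule.sum_mem _ fun T' hT' => Submodule.smul_mem _ _
      (h' T' (Finset.ne_of_mem_erase hT')
        (Finsupp.mem_support_iff.1 (Finset.mem_of_mem_erase hT')))
  rw [Submodule.add_mem_iff_left _ h1] at h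
  exact (Submodule.smul_mem_iff _ hT).1 h

/-- The constant weight `1` counts all digits of `T`; a splitting without carries would give at
least two. -/
theorem eq_single_of_digitWeight_one (hp : p.Prime) {T : ℕ →₀ ℕ}
    (h : digitWeight p (fun _ => 1) T = 1) : ∃ t k, T = Finsupp.single t (p ^ k) := by
  have hT : T ≠ 0 := by rintro rfl; simp [digitWeight_zero] at h
  rcases eq_single_or_exists_add hp hT with h1 | ⟨R, S, hR, hS, rfl, hd⟩
  · exact h1
  · rw [digitWeight_add_of_digitSum _ _ _ hd] at h
    have h2 : digitWeight p (fun _ => 1) R ≠ 0 := fun h0 =>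
      hR (eq_zero_of_digitWeight_eq_zero _ hp (fun _ => one_ne_zero) h0)
    have h3 : digitWeight p (fun _ => 1) S ≠ 0 := fun h0 =>
      hS (eq_zero_of_digitWeight_eq_zero _ hp (fun _ => one_ne_zero) h0)
    lia

theorem prod_choose_ne_zero (hp : p.Prime) [CharP F p] {R S : ℕ →₀ ℕ}
    (h : ∀ k, digitSum p (R k + S k) = digitSum p (R k) + digitSum p (S k)) :
    ((R + S).prod fun k a => (a.choose (R k) : F)) ≠ 0 := by
  refine Finset.prod_ne_zero_iff.2 fun k _ => ?_
  rw [Finsupp.add_apply, Ne, CharP.cast_eq_zero_iff F p]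
  exact not_dvd_choose_of_digitSum_add hp (h k)

/-- A multiplicative filtration whose first step contains all Steenrod powers of positive degree
contains the Milnor operations in the steps given by their weights. -/
theorem seqOp_mem_filtration (hp : p.Prime) (he : e ≠ 0) [CharP F p]
    {J : ℕ → Submodule F (Module.End F (MvPolynomial ℕ F))} (hJ : Antitone J)
    (hmul : ∀ a b x y, x ∈ J a → y ∈ J b → x * y ∈ J (a + b)) (h0 : 1 ∈ J 0)
    (h1 : ∀ n ≠ 0, steenrodOp F (p ^ e) n ∈ J 1) (T : ℕ →₀ ℕ) :
    seqOp F (p ^ e) T ∈ J (digitWeight p (fun k => k + 1) T) := by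
  have hq : 1 < p ^ e := Nat.one_lt_pow he hp.one_lt
  induction hD : milnorDegree (p ^ e) T using Nat.strong_induction_on generalizing T with
  | _ D ihD =>
  -- Inner induction, downwards on the strict weight within degree `D`.
  induction hm : 3 * D - digitWeight p (fun k => 3 * k + 2) T using Nat.strong_induction_on
    generalizing T with
  | _ m ihm =>
  have key : ∀ T', milnorDegree (p ^ e) T' = D →
      digitWeight p (fun k => 3 * k + 2) T < digitWeight p (fun k => 3 * k + 2) T' →
      seqOp F (p ^ e) T' ∈ J (digitWeight p (fun k => k + 1) T') := by
    intro T' hT' hlt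
    have := digitWeight_le_milnorDegree (p := p) hq T'
    exact ihm _ (by lia) T' hT' rfl
  have hdeg : ∀ {R : ℕ →₀ ℕ}, R ≠ 0 → milnorDegree (p ^ e) R ≠ 0 := fun hR h =>
    hR (milnorDegree_eq_zero hq h)
  by_cases hT0 : T = 0
  · rw [hT0, seqOp_zero, digitWeight_zero]
    exact h0
  rcases eq_single_or_exists_add hp hT0 with ⟨t, k, hT⟩ | ⟨R, S, hR, hS, hRS, hd⟩
  · cases t with
    | zero =>
      rw [hT, digitWeight_single, digitSum_pow hp.one_lt, ← steenrodOp_eq_seqOp]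
      exact h1 _ (pow_pos hp.pos k).ne'
    | succ t =>
      -- `R` and `S` are read off from the leading term `s_1^(q^(t+1) p^k) t_(t+1)^(p^k)` of the
      -- coproduct of `ξ_(t+2)^(p^k)`.
      set R : ℕ →₀ ℕ := Finsupp.single 0 (leadExp (p ^ e) T) with hR
      set S : ℕ →₀ ℕ := Finsupp.single t (p ^ k) with hS
      have hlead : leadExp (p ^ e) T = p ^ (e * (t + 1)) * p ^ k := by
        rw [hT, leadExp_single, ← pow_mul, mul_comm]
      have hR0 : R ≠ 0 := by
        rw [hR, Ne, Finsupp.single_eq_zero, hlead, ← pow_add]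
        exact (pow_pos hp.pos _).ne'
      have hS0 : S ≠ 0 := by
        rw [hS, Ne, Finsupp.single_eq_zero]
        exact (pow_pos hp.pos _).ne'
      have hshift : S = shiftExp T := by
        ext i
        rw [shiftExp_apply, hT, hS, Finsupp.single_apply, Finsupp.single_apply]
        simp
      have wR : ∀ w : ℕ → ℕ, digitWeight p w R = w 0 := fun w => by
        rw [hR, digitWeight_single, hlead, ← pow_add, digitSum_pow hp.one_lt, mul_one]
      have wS : ∀ w : ℕ → ℕ, digitWeight p w S = w t := fun w => by
        rw [hS, digitWeight_single, digitSum_pow hp.one_lt, mul_one]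
      have wT : ∀ w : ℕ → ℕ, digitWeight p w T = w (t + 1) := fun w => by
        rw [hT, digitWeight_single, digitSum_pow hp.one_lt, mul_one]
      obtain ⟨c, hc, hc1, -, hc3, hc4, hc5, -, hc7⟩ := exists_seqOp_mul F hp he R S
      obtain ⟨d, hd, hd1, hd2, hd3, hd4, hd5, -, -⟩ := exists_seqOp_mul F hp he S R
      have hcT : c T = 1 := by rw [hc7 T hR, if_pos hshift]
      -- In the opposite order `R` is the exponent of `t`, and its total degree `q^(t+1) p^k`
      -- exceeds that of `T`.
      have hdT : d T = 0 := by
        by_contra h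
        have := hd2 T h
        rw [hR, hT, Finsupp.degree_single, Finsupp.degree_single, ← hT, hlead] at this
        have h2 : 1 < p ^ (e * (t + 1)) :=
          Nat.one_lt_pow (mul_ne_zero he (Nat.succ_ne_zero t)) hp.one_lt
        have h3 := Nat.mul_lt_mul_of_pos_right h2 (pow_pos hp.pos k)
        lia
      have hDe : D = milnorDegree (p ^ e) R + milnorDegree (p ^ e) S := by
        rw [← hD]
        exact hc1 T (by rw [hcT]; exact one_ne_zero)
      have jR := ihD (milnorDegree (p ^ e) R) (by have := hdeg hS0; lia) R rfl
      have jS := ihD (milnorDegree (p ^ e) S) (by have := hdeg hR0; lia) S rfl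
      rw [wR] at jR
      rw [wS] at jS
      rw [wT]
      -- The commutator is needed because `P(R + S)` occurs in each of the two products and need not
      -- have larger strict weight than `T`. Its coefficients agree by the symmetry of binomial
      -- coefficients.
      refine seqOp_mem_of_linearCombination_mem (c := c - d) ?_ ?_ ?_
      · rw [map_sub, ← hc, ← hd]
        have h2 := hmul _ _ _ _ jR jS
        have h3 := hmul _ _ _ _ jS jR
        rw [show 0 + 1 + (t + 1) = t + 1 + 1 by lia] at h2
        rw [show t + 1 + (0 + 1) = t + 1 + 1 by lia] at h3
        exact Submodule.sub_mem _ h2 h3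
      · rw [Finsupp.sub_apply, hcT, hdT, sub_zero]
        exact one_ne_zero
      · intro T' hne hT'
        have hRS : T' ≠ R + S := by
          rintro rfl
          apply hT'
          rw [Finsupp.sub_apply, hc5, add_comm R S, hd5, sub_eq_zero]
          refine Finset.prod_congr rfl fun i _ => ?_
          dsimp only
          rw [Finsupp.add_apply, Nat.choose_symm_add]
        have hor : c T' ≠ 0 ∨ d T' ≠ 0 := by
          by_contra! h
          apply hT'
          rw [Finsupp.sub_apply, h.1, h.2, sub_zero]
        have b1 : milnorDegree (p ^ e) T' = D := by
          rcases hor with h | h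
          · rw [hc1 T' h, hDe]
          · rw [hd1 T' h, hDe, add_comm]
        have b2 : t + 2 ≤ digitWeight p (fun k => k + 1) T' := by
          rcases hor with h | h
          · have := hc3 (fun k => k + 1) (by intros; lia) T' h
            rw [wR, wS] at this
            lia
          · have := hd3 (fun k => k + 1) (by intros; lia) T' h
            rw [wR, wS] at this
            lia
        have b3 : 2 * t + 3 ≤ digitWeight p (fun k => 2 * k + 1) T' := by
          rcases hor with h | h
          · have := hc4 (fun k => 2 * k + 1) (by intros; lia) T' hRS h
            rw [wR, wS] at this
            lia
          · have := hd4 (fun k => 2 * k + 1) (by intros; lia) T' (by rwa [add_comm]) h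
            rw [wR, wS] at this
            lia
        have e1 : digitWeight p (fun k => 3 * k + 2) T' =
            digitWeight p (fun k => 2 * k + 1) T' + digitWeight p (fun k => k + 1) T' := by
          rw [← digitWeight_add_weight]
          congr 1
          funext k
          lia
        have e2 : digitWeight p (fun k => k + 1) T' + digitWeight p (fun k => k + 1) T' =
            digitWeight p (fun k => 2 * k + 1) T' + digitWeight p (fun _ => 1) T' := by
          rw [← digitWeight_add_weight, ← digitWeight_add_weight]
          congr 1
          funext k
          lia
        -- By `b2` and `b3` the strict weight of `T'` is at least `3 * t + 5`, that of `T`. In case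
        -- of equality both bounds are attained, so `e2` leaves a single digit. The weight then
        -- gives its position and the degree its value, which forces `T' = T`.
        refine hJ b2 (key T' b1 ?_)
        rw [wT]
        by_contra hlt
        apply hne
        obtain ⟨i, l, hi⟩ := eq_single_of_digitWeight_one hp (T := T') (by lia)
        have b4 : digitWeight p (fun k => k + 1) T' = i + 1 := by
          rw [hi, digitWeight_single, digitSum_pow hp.one_lt, mul_one]
        have hit : i = t + 1 := by lia
        rw [hi, hT, hit]
        rw [← hD, hi, hT, milnorDegree_single, milnorDegree_single, hit] at b1
        have b5 : 0 < (p ^ e) ^ (t + 1 + 1) - 1 := by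
          have := Nat.one_lt_pow (Nat.succ_ne_zero (t + 1)) hq
          simp only [Nat.succ_eq_add_one] at this
          lia
        rw [Nat.eq_of_mul_eq_mul_right b5 b1]
  · obtain ⟨c, hc, hc1, -, hc3, hc4, hc5, -, -⟩ := exists_seqOp_mul F hp he R S
    have hDe : D = milnorDegree (p ^ e) R + milnorDegree (p ^ e) S := by
      rw [← hD, ← hRS, map_add]
    have hw : ∀ w, digitWeight p w T = digitWeight p w R + digitWeight p w S := fun w => by
      rw [← hRS, digitWeight_add_of_digitSum w R S hd]
    have jR := ihD (milnorDegree (p ^ e) R) (by have := hdeg hS; lia) R rfl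
    have jS := ihD (milnorDegree (p ^ e) S) (by have := hdeg hR; lia) S rfl
    refine seqOp_mem_of_linearCombination_mem (c := c) ?_ ?_ ?_
    · rw [← hc, hw]
      exact hmul _ _ _ _ jR jS
    · rw [← hRS, hc5]
      exact prod_choose_ne_zero hp hd
    · intro T' hne hT'
      have b2 := hc3 (fun k => k + 1) (by intros; lia) T' hT'
      have b3 := hc4 (fun k => 3 * k + 2) (by intros; lia) T' (by rwa [hRS]) hT'
      rw [← hw] at b2 b3
      exact hJ b2 (key T' (by rw [hc1 T' hT', hDe]) b3)

end

/-! ### Admissible monomials -/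

section
open MvPolynomial

/-- The product of Steenrod powers with the exponents in a list. -/
noncomputable def steenrodWord (F : Type*) [Field F] (l : List ℕ) : SteenrodAlgebra F :=
  (l.map (steenrodPower F)).prod

/-- A list of exponents is admissible if each is at least `q` times the next one. -/
def IsAdmissible (q : ℕ) (l : List ℕ) : Prop := l.IsChain fun a b => q * b ≤ a

/-- The moment `∑ i a_i` of a list. -/
def listMoment : List ℕ → ℕ
  | [] => 0
  | _ :: l => l.sum + listMoment l

/-- An Adem relation replaces the exponents `a, b` by `a + b - j, j` with `j < b`. This keeps the
sum and lowers the moment, so rewriting terminates. -/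
theorem listMoment_lt (u v : List ℕ) {a b c d : ℕ} (h : c + d = a + b) (hd : d < b) :
    listMoment (u ++ c :: d :: v) < listMoment (u ++ a :: b :: v) := by
  induction u with
  | nil => simp [listMoment]; lia
  | cons x u ih =>
    simp only [List.cons_append, listMoment, List.sum_append, List.sum_cons]
    lia

theorem exists_of_not_isAdmissible {q : ℕ} {l : List ℕ} (h : ¬ IsAdmissible q l) :
    ∃ u a b v, l = u ++ a :: b :: v ∧ a < q * b := by
  induction l with
  | nil => exact absurd List.IsChain.nil h
  | cons x l ih =>
    cases l with
    | nil => exact absurd (List.IsChain.singleton x) h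
    | cons y l =>
      by_cases hxy : q * y ≤ x
      · have : ¬ IsAdmissible q (y :: l) := fun h' => h (List.isChain_cons_cons.2 ⟨hxy, h'⟩)
        obtain ⟨u, a, b, v, e, hab⟩ := ih this
        exact ⟨x :: u, a, b, v, by rw [e, List.cons_append], hab⟩
      · exact ⟨[], x, y, l, rfl, not_le.1 hxy⟩

/-- The first `k` terms of the admissible sequence that belongs to `T`. -/
noncomputable def leadList (q : ℕ) : ℕ → (ℕ →₀ ℕ) → List ℕ
  | 0, _ => []
  | k + 1, T => leadExp q T :: leadList q k (shiftExp T)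

theorem leadExp_mapDomain_succ (q : ℕ) (T : ℕ →₀ ℕ) :
    leadExp q (T.mapDomain Nat.succ) = q * leadExp q T := by
  induction T using Finsupp.induction_linear with
  | zero => simp
  | add R S hR hS => rw [Finsupp.mapDomain_add, map_add, hR, hS, map_add, mul_add]
  | single k a =>
    rw [Finsupp.mapDomain_single, leadExp_single, leadExp_single, Nat.succ_eq_add_one, pow_succ]
    ring

/-- Milnor's correspondence: the entries of `T` are the differences `a_i - q a_(i+1)`, which
admissibility makes nonnegative. -/
theorem exists_leadList_eq {q : ℕ} {l : List ℕ} (h : IsAdmissible q l) :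
    ∃ T : ℕ →₀ ℕ, (∀ k ∈ T.support, k < l.length) ∧ leadList q l.length T = l := by
  induction l with
  | nil => exact ⟨0, by simp, rfl⟩
  | cons a l ih =>
    obtain ⟨T, hT, hl⟩ := ih (List.IsChain.tail h)
    have ha : q * leadExp q T ≤ a := by
      cases l with
      | nil =>
        have : T = 0 := by
          ext k
          by_contra hk
          exact absurd (hT k (Finsupp.mem_support_iff.2 hk)) (by simp)
        simp [this]
      | cons b l =>
        have h1 : leadExp q T = b := by
          have := congrArg List.head? hl
          simpa [leadList] using this
        rw [h1]
        exact (List.isChain_cons_cons.1 h).1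
    set T' : ℕ →₀ ℕ := Finsupp.single 0 (a - q * leadExp q T) + T.mapDomain Nat.succ
    have hs : shiftExp T' = T := by
      ext k
      rw [shiftExp_apply]
      have := Finsupp.mapDomain_apply Nat.succ_injective T k
      simp only [T', Finsupp.add_apply]
      rw [← Nat.succ_eq_add_one, this]
      simp
    refine ⟨T', ?_, ?_⟩
    · intro k hk
      cases k with
      | zero => simp
      | succ k =>
        have : k ∈ T.support := by
          rw [Finsupp.mem_support_iff, ← hs, shiftExp_apply]
          exact Finsupp.mem_support_iff.1 hk
        have := hT k this
        simp only [List.length_cons]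
        lia
    · rw [List.length_cons, leadList, hs, hl]
      congr 1
      simp only [T', map_add, leadExp_mapDomain_succ, leadExp_single]
      lia

variable (F : Type*) [Field F]

theorem steenrodPower_zero : steenrodPower F 0 = 1 := by
  rw [steenrodPower, RingQuot.mkAlgHom_rel F AdemRel.zero, map_one]

theorem steenrodPower_mul_of_lt {a b : ℕ} (h : a < Nat.card F * b) :
    steenrodPower F a * steenrodPower F b =
      ∑ j ∈ Finset.range (a / Nat.card F + 1),
        ((-1 : F) ^ (a + j) *
          (((Nat.card F - 1) * (b - j) - 1).choose (a - Nat.card F * j) : F)) •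
            (steenrodPower F (a + b - j) * steenrodPower F j) := by
  have := RingQuot.mkAlgHom_rel F (AdemRel.adem (F := F) (q := Nat.card F) a b h)
  simp only [map_mul, map_sum, map_smul] at this
  exact this

theorem steenrodWord_append (l m : List ℕ) :
    steenrodWord F (l ++ m) = steenrodWord F l * steenrodWord F m := by
  simp [steenrodWord]

/-- The span of the admissible monomials of a given length. -/
noncomputable def admissibleSpan (k : ℕ) : Submodule F (SteenrodAlgebra F) :=
  Submodule.span F (steenrodWord F '' {l | IsAdmissible (Nat.card F) l ∧ l.length = k})

/-- Factors `P^0` are kept, so that Adem relations preserve the length. Words can then be compared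
lexicographically at equal length. -/
theorem steenrodWord_mem_admissibleSpan (l : List ℕ) :
    steenrodWord F l ∈ admissibleSpan F l.length := by
  induction hm : listMoment l using Nat.strong_induction_on generalizing l with
  | _ m ih =>
    by_cases h : IsAdmissible (Nat.card F) l
    · exact Submodule.subset_span ⟨l, ⟨h, rfl⟩, rfl⟩
    · obtain ⟨u, a, b, v, rfl, hab⟩ := exists_of_not_isAdmissible h
      have hsplit : ∀ c d : ℕ, steenrodWord F (u ++ c :: d :: v) =
          steenrodWord F u * (steenrodPower F c * steenrodPower F d) * steenrodWord F v := by
        intro c d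
        simp [steenrodWord, mul_assoc]
      rw [hsplit, steenrodPower_mul_of_lt F hab, Finset.mul_sum, Finset.sum_mul]
      refine Submodule.sum_mem _ fun j hj => ?_
      rw [mul_smul_comm, smul_mul_assoc, ← hsplit]
      refine Submodule.smul_mem _ _ ?_
      have h1 := Finset.mem_range.1 hj
      have h2 : a / Nat.card F < b := Nat.div_lt_of_lt_mul hab
      have h3 : a / Nat.card F ≤ a := Nat.div_le_self _ _
      have h4 := ih _ (by
        rw [← hm]
        exact listMoment_lt u v (c := a + b - j) (d := j) (by lia) (by lia)) _ rfl
      simpa using h4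

theorem admissibleSpan_mono : Monotone (admissibleSpan F) := by
  refine monotone_nat_of_le_succ fun k => Submodule.span_le.2 ?_
  rintro _ ⟨l, ⟨_, rfl⟩, rfl⟩
  have h := steenrodWord_mem_admissibleSpan F (l ++ [0])
  have e : steenrodWord F (l ++ [0]) = steenrodWord F l := by
    simp [steenrodWord, steenrodPower_zero]
  rw [e, List.length_append] at h
  exact h

theorem span_range_steenrodWord :
    Submodule.span F (Set.range (steenrodWord F)) = ⊤ := by
  have h1 : Algebra.adjoin F (Set.range (steenrodPower F)) = ⊤ := by
    have h2 := congrArg (Subalgebra.map (RingQuot.mkAlgHom F (AdemRel F (Nat.card F))))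
      (FreeAlgebra.adjoin_range_ι F ℕ)
    rw [AlgHom.map_adjoin, ← Set.range_comp, Algebra.map_top,
      (AlgHom.range_eq_top _).2 (RingQuot.mkAlgHom_surjective F _)] at h2
    exact h2
  have h3 := Algebra.adjoin_eq_span F (Set.range (steenrodPower F))
  rw [h1] at h3
  rw [eq_top_iff, ← Algebra.top_toSubmodule, h3, Submodule.span_le]
  refine fun x hx => Submodule.subset_span ?_
  induction hx using Submonoid.closure_induction with
  | mem x hx =>
    obtain ⟨r, rfl⟩ := hx
    exact ⟨[r], by simp [steenrodWord]⟩
  | one => exact ⟨[], rfl⟩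
  | mul x y _ _ hx hy =>
    obtain ⟨l, rfl⟩ := hx
    obtain ⟨m, rfl⟩ := hy
    exact ⟨l ++ m, steenrodWord_append F l m⟩

theorem exists_mem_admissibleSpan (θ : SteenrodAlgebra F) : ∃ k, θ ∈ admissibleSpan F k := by
  have h : θ ∈ Submodule.span F (Set.range (steenrodWord F)) := by
    rw [span_range_steenrodWord]; trivial
  induction h using Submodule.span_induction with
  | mem x hx =>
    obtain ⟨l, rfl⟩ := hx
    exact ⟨_, steenrodWord_mem_admissibleSpan F l⟩
  | zero => exact ⟨0, Submodule.zero_mem _⟩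
  | add x y _ _ hx hy =>
    obtain ⟨k, hk⟩ := hx
    obtain ⟨m, hm⟩ := hy
    exact ⟨max k m, Submodule.add_mem _ (admissibleSpan_mono F (le_max_left k m) hk)
      (admissibleSpan_mono F (le_max_right k m) hm)⟩
  | smul c x _ hx =>
    obtain ⟨k, hk⟩ := hx
    exact ⟨k, Submodule.smul_mem _ _ hk⟩

/-! ### The action on polynomials is faithful -/

/-- The expansion of a monomial in the Steenrod powers in Milnor operations is triangular with
respect to the lexicographic order. -/
theorem exists_steenrodAction_word [Finite F] {p e : ℕ} (hp : p.Prime) (he : e ≠ 0) [CharP F p]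
    (hF : Nat.card F = p ^ e) (l : List ℕ) :
    ∃ g : (ℕ →₀ ℕ) →₀ F,
      steenrodAction F (steenrodWord F l) = Finsupp.linearCombination F (seqOp F (p ^ e)) g ∧
      (∀ T, g T ≠ 0 → l < leadList (p ^ e) l.length T ∨ l = leadList (p ^ e) l.length T) ∧
      ∀ T, (∀ k ∈ T.support, k < l.length) → leadList (p ^ e) l.length T = l → g T = 1 := by
  classical
  induction l with
  | nil =>
    refine ⟨Finsupp.single 0 1, ?_, ?_, ?_⟩
    · rw [Finsupp.linearCombination_single, one_smul, seqOp_zero, steenrodWord, List.map_nil,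
        List.prod_nil, map_one]
    · exact fun T _ => Or.inr rfl
    · intro T hT _
      have : T = 0 := by
        ext k
        by_contra hk
        exact absurd (hT k (Finsupp.mem_support_iff.2 hk)) (by simp)
      rw [this, Finsupp.single_eq_same]
  | cons a l ih =>
    obtain ⟨g, hg, hg1, hg2⟩ := ih
    choose c hc _ _ _ _ _ hc1 hc2 using
      fun S => exists_seqOp_mul F hp he (Finsupp.single 0 a) S
    have hval : ∀ T, (g.sum fun S b => b • c S) T = g.sum fun S b => b * c S T := by
      intro T
      rw [Finsupp.sum_apply]
      rfl
    refine ⟨g.sum fun S b => b • c S, ?_, ?_, ?_⟩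
    · have : steenrodWord F (a :: l) = steenrodPower F a * steenrodWord F l := by
        simp [steenrodWord]
      rw [this, map_mul, hg, steenrodAction_steenrodPower, hF, steenrodOp_eq_seqOp,
        Finsupp.linearCombination_apply, Finsupp.sum, Finset.mul_sum, Finsupp.sum, map_sum]
      refine Finset.sum_congr rfl fun S _ => ?_
      rw [mul_smul_comm, hc, map_smul]
    · intro T hT
      rw [hval, Finsupp.sum] at hT
      obtain ⟨S, _, hS⟩ := Finset.exists_ne_zero_of_sum_ne_zero hT
      have h1 := hg1 S (left_ne_zero_of_mul hS)
      have h2 := hc1 S a T rfl (right_ne_zero_of_mul hS)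
      simp only [List.length_cons, leadList]
      rw [List.cons_lt_cons_iff, List.cons_eq_cons]
      -- If the first exponents agree, only the leading term in `s_1` contributes, and the
      -- comparison passes to the tails.
      rcases h2.lt_or_eq with h2 | h2
      · exact Or.inl (Or.inl h2)
      · have h3 := hc2 S T (by rw [h2])
        have h4 : S = shiftExp T := by
          by_contra h
          rw [if_neg h] at h3
          exact right_ne_zero_of_mul hS h3
        rw [← h4]
        rcases h1 with h1 | h1
        · exact Or.inl (Or.inr ⟨h2, h1⟩)
        · exact Or.inr ⟨h2, h1⟩
    · intro T hT hl
      simp only [List.length_cons, leadList, List.cons_eq_cons] at hl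
      have h1 : ∀ S, c S T = if S = shiftExp T then 1 else 0 := fun S =>
        hc2 S T (by rw [hl.1])
      have h2 : g (shiftExp T) = 1 := by
        refine hg2 _ (fun k hk => ?_) hl.2
        rw [Finsupp.mem_support_iff, shiftExp_apply] at hk
        have := hT (k + 1) (Finsupp.mem_support_iff.2 hk)
        simp only [List.length_cons] at this
        lia
      rw [hval, Finsupp.sum]
      simp only [h1, mul_ite, mul_one, mul_zero]
      rw [Finset.sum_ite_eq', if_pos (Finsupp.mem_support_iff.2 (by rw [h2]; exact one_ne_zero)),
        h2]

theorem steenrodAction_injective [Finite F] {p e : ℕ} (hp : p.Prime) (he : e ≠ 0) [CharP F p]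
    (hF : Nat.card F = p ^ e) : Function.Injective (steenrodAction F) := by
  rw [injective_iff_map_eq_zero]
  intro θ hθ
  have hq : 1 < p ^ e := Nat.one_lt_pow he hp.one_lt
  obtain ⟨k, hk⟩ := exists_mem_admissibleSpan F θ
  obtain ⟨b, hb, rfl⟩ := (Finsupp.mem_span_image_iff_linearCombination F).1 hk
  by_cases hb0 : b = 0
  · rw [hb0, map_zero]
  exfalso
  -- Take the lexicographically least word `l₀` in a relation and the `T₀` that belongs to it. A
  -- word `l` that contains `P(T₀)` satisfies `l ≤ l₀`, so only `l₀` does, and with coefficient `1`.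
  obtain ⟨l₀, hl₀, hmin⟩ := Finset.exists_min_image b.support id (Finsupp.support_nonempty_iff.2 hb0)
  have hadm : ∀ l ∈ b.support, IsAdmissible (Nat.card F) l ∧ l.length = k := fun l hl => hb hl
  choose g hg hg1 hg2 using exists_steenrodAction_word F hp he hF
  have h0 : b.sum (fun l c => c • g l) = 0 := by
    apply (linearIndependent_seqOp F hq).finsuppLinearCombination_injective
    rw [map_zero, map_finsuppSum, ← hθ, Finsupp.linearCombination_apply, map_finsuppSum]
    refine Finsupp.sum_congr fun l _ => ?_
    rw [map_smul, map_smul, hg]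
  obtain ⟨T₀, hT₀, hl⟩ := exists_leadList_eq (hadm l₀ hl₀).1
  rw [hF] at hl
  have h1 := DFunLike.congr_fun h0 T₀
  rw [Finsupp.sum_apply, Finsupp.sum, Finset.sum_eq_single l₀] at h1
  · rw [Finsupp.smul_apply, hg2 l₀ T₀ hT₀ hl, smul_eq_mul, mul_one] at h1
    exact Finsupp.mem_support_iff.1 hl₀ h1
  · intro l hl' hne
    rw [Finsupp.smul_apply]
    by_contra h
    have h2 := hg1 l T₀ (right_ne_zero_of_smul h)
    rw [(hadm l hl').2, ← (hadm l₀ hl₀).2, hl] at h2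
    rcases h2 with h2 | h2
    · exact absurd (hmin l hl') (not_le.2 h2)
    · exact hne h2
  · exact fun h => absurd hl₀ h

/-! ### May filtration -/

theorem steenrodAction_mem_span [Finite F] {p e : ℕ} (hp : p.Prime) (he : e ≠ 0) [CharP F p]
    (hF : Nat.card F = p ^ e) (θ : SteenrodAlgebra F) :
    steenrodAction F θ ∈ Submodule.span F (Set.range (seqOp F (p ^ e))) := by
  have h : θ ∈ Submodule.span F (Set.range (steenrodWord F)) := by
    rw [span_range_steenrodWord]; trivial
  induction h using Submodule.span_induction with
  | mem x hx =>
    obtain ⟨l, rfl⟩ := hx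
    obtain ⟨g, hg, -⟩ := exists_steenrodAction_word F hp he hF l
    rw [hg, Finsupp.mem_span_range_iff_exists_finsupp]
    exact ⟨g, rfl⟩
  | zero => rw [map_zero]; exact Submodule.zero_mem _
  | add x y _ _ hx hy => rw [map_add]; exact Submodule.add_mem _ hx hy
  | smul c x _ hx => rw [map_smul]; exact Submodule.smul_mem _ _ hx

/-- Positive Steenrod powers annihilate `1`. Evaluation at `1` thus shows that elements of the
augmentation ideal have no `P(0)` term. -/
theorem steenrodAction_apply_one [Finite F] (θ : SteenrodAlgebra F) :
    steenrodAction F θ 1 = C (augmentation F θ) := by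
  have h : θ ∈ Submodule.span F (Set.range (steenrodWord F)) := by
    rw [span_range_steenrodWord]; trivial
  induction h using Submodule.span_induction with
  | mem x hx =>
    obtain ⟨l, rfl⟩ := hx
    induction l with
    | nil => simp [steenrodWord]
    | cons a l ih =>
      have : steenrodWord F (a :: l) = steenrodPower F a * steenrodWord F l := by
        simp [steenrodWord]
      rw [this, map_mul, Module.End.mul_apply, ih, map_mul, steenrodAction_steenrodPower,
        augmentation_steenrodPower, steenrodOp_eq_seqOp, ← mul_one (C _), ← smul_eq_C_mul, map_smul]
      by_cases ha : a = 0
      · subst ha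
        rw [Finsupp.single_zero, seqOp_zero, if_pos rfl, one_mul, Module.End.one_apply,
          smul_eq_C_mul, mul_one]
      · rw [seqOp_apply_one _ _ (by simpa using ha), if_neg ha, smul_zero, zero_mul, map_zero]
  | zero => simp
  | add x y _ _ hx hy => rw [map_add, LinearMap.add_apply, hx, hy, map_add, map_add]
  | smul c x _ hx =>
    rw [map_smul, LinearMap.smul_apply, hx, map_smul, smul_eq_mul, C_mul, smul_eq_C_mul]

/-- The span of the Milnor operations of weight at least `m`. -/
noncomputable def weightSpan (p q m : ℕ) : Submodule F (Module.End F (MvPolynomial ℕ F)) :=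
  Submodule.span F (seqOp F q '' {T | m ≤ digitWeight p (fun k => k + 1) T})

theorem mul_mem_weightSpan {p e : ℕ} (hp : p.Prime) (he : e ≠ 0) [CharP F p] {a b : ℕ}
    {x y : Module.End F (MvPolynomial ℕ F)} (hx : x ∈ weightSpan F p (p ^ e) a)
    (hy : y ∈ weightSpan F p (p ^ e) b) : x * y ∈ weightSpan F p (p ^ e) (a + b) := by
  have h1 := Submodule.mul_mem_mul hx hy
  rw [weightSpan, weightSpan, Submodule.span_mul_span] at h1
  refine Submodule.span_le.2 ?_ h1
  rintro _ ⟨_, ⟨R, hR, rfl⟩, _, ⟨S, hS, rfl⟩, rfl⟩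
  obtain ⟨c, hc, -, -, hc3, -⟩ := exists_seqOp_mul F hp he R S
  simp only [hc, Finsupp.linearCombination_apply]
  refine Submodule.sum_mem _ fun T hT => Submodule.smul_mem _ _ (Submodule.subset_span ⟨T, ?_, rfl⟩)
  have h2 := hc3 (fun k => k + 1) (by intros; lia) T (Finsupp.mem_support_iff.1 hT)
  exact (add_le_add hR hS).trans h2

theorem steenrodAction_mem_weightSpan_one [Finite F] {p e : ℕ} (hp : p.Prime) (he : e ≠ 0)
    [CharP F p] (hF : Nat.card F = p ^ e) {θ : SteenrodAlgebra F}
    (hθ : θ ∈ augmentationIdeal F) : steenrodAction F θ ∈ weightSpan F p (p ^ e) 1 := by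
  classical
  obtain ⟨g, hg⟩ := (Finsupp.mem_span_range_iff_exists_finsupp).1
    (steenrodAction_mem_span F hp he hF θ)
  have h0 : g 0 = 0 := by
    have h1 := steenrodAction_apply_one F θ
    rw [(RingHom.mem_ker).1 hθ, map_zero, ← hg, Finsupp.sum, LinearMap.sum_apply,
      Finset.sum_eq_single 0] at h1
    · rw [LinearMap.smul_apply, seqOp_zero, Module.End.one_apply, smul_eq_C_mul, mul_one] at h1
      exact C_injective _ _ (h1.trans (map_zero C).symm)
    · intro T _ hT
      rw [LinearMap.smul_apply, seqOp_apply_one _ _ hT, smul_zero]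
    · intro h
      rw [Finsupp.notMem_support_iff.1 h, zero_smul, LinearMap.zero_apply]
  rw [← hg]
  refine Submodule.sum_mem _ fun T hT => Submodule.smul_mem _ _ (Submodule.subset_span ⟨T, ?_, rfl⟩)
  refine Nat.one_le_iff_ne_zero.2 fun h => Finsupp.mem_support_iff.1 hT ?_
  rw [eq_zero_of_digitWeight_eq_zero _ hp (fun k => Nat.succ_ne_zero k) h, h0]

theorem steenrodAction_mem_weightSpan [Finite F] {p e : ℕ} (hp : p.Prime) (he : e ≠ 0)
    [CharP F p] (hF : Nat.card F = p ^ e) (m : ℕ) {θ : SteenrodAlgebra F}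
    (hθ : θ ∈ augmentationIdeal F ^ m) : steenrodAction F θ ∈ weightSpan F p (p ^ e) m := by
  induction m generalizing θ with
  | zero =>
    have := steenrodAction_mem_span F hp he hF θ
    simpa [weightSpan] using this
  | succ m ih =>
    rw [Submodule.pow_succ] at hθ
    refine Submodule.mul_induction_on hθ (fun x hx y hy => ?_) (fun x y hx hy => ?_)
    · rw [map_mul]
      exact mul_mem_weightSpan F hp he (ih hx) (steenrodAction_mem_weightSpan_one F hp he hF hy)
    · rw [map_add]
      exact Submodule.add_mem _ hx hy

/-- `seqOp_mem_filtration` for the images of the powers of the ideal. This gives the existence of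
Milnor basis elements along with the lower bound for their filtration. -/
theorem exists_mem_augmentationIdeal_pow [Finite F] {p e : ℕ} (hp : p.Prime) (he : e ≠ 0)
    [CharP F p] (hF : Nat.card F = p ^ e) (T : ℕ →₀ ℕ) :
    ∃ θ ∈ augmentationIdeal F ^ digitWeight p (fun k => k + 1) T,
      steenrodAction F θ = seqOp F (p ^ e) T := by
  have htwo : (augmentationIdeal F).IsTwoSided := by
    unfold augmentationIdeal; infer_instance
  let J : ℕ → Submodule F (Module.End F (MvPolynomial ℕ F)) := fun m =>
    ((augmentationIdeal F ^ m).restrictScalars F).map (steenrodAction F).toLinearMap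
  have h := seqOp_mem_filtration (J := J) hp he ?_ ?_ ?_ ?_ T
  · obtain ⟨θ, h1, h2⟩ := h
    exact ⟨θ, h1, h2⟩
  · intro a b hab
    exact Submodule.map_mono (Ideal.pow_le_pow_right hab)
  · rintro a b _ _ ⟨x, hx, rfl⟩ ⟨y, hy, rfl⟩
    refine ⟨x * y, ?_, map_mul (steenrodAction F) x y⟩
    have hx' : x ∈ augmentationIdeal F ^ a := hx
    have hy' : y ∈ augmentationIdeal F ^ b := hy
    show x * y ∈ augmentationIdeal F ^ (a + b)
    -- For `b = 0` the second factor is arbitrary, and that the ideal is two-sided is what is used.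
    rcases Nat.eq_zero_or_pos b with rfl | hb
    · exact Ideal.mul_mem_right _ _ hx'
    · rw [Submodule.pow_add _ hb.ne']
      exact Ideal.mul_mem_mul hx' hy'
  · refine ⟨1, ?_, map_one (steenrodAction F)⟩
    show (1 : SteenrodAlgebra F) ∈ augmentationIdeal F ^ 0
    rw [Submodule.pow_zero, Ideal.one_eq_top]
    trivial
  · intro n hn
    refine ⟨steenrodPower F n, ?_, ?_⟩
    · show steenrodPower F n ∈ augmentationIdeal F ^ 1
      rw [Submodule.pow_one]
      refine (RingHom.mem_ker).2 ?_
      rw [augmentation_steenrodPower, if_neg hn]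
    · rw [← hF]
      exact steenrodAction_steenrodPower F n

theorem digitWeight_mapDomain_val (p : ℕ) (w : ℕ → ℕ) {ℓ : ℕ} (R : Fin ℓ → ℕ) :
    digitWeight p w ((Finsupp.equivFunOnFinite.symm R).mapDomain Fin.val) =
      ∑ i : Fin ℓ, w i.val * digitSum p (R i) := by
  classical
  rw [digitWeight_eq_sum w _ (s := Finset.range ℓ), Finset.sum_range]
  · refine Finset.sum_congr rfl fun i _ => ?_
    rw [Finsupp.mapDomain_apply Fin.val_injective]
    rfl
  · intro k hk
    obtain ⟨i, _, rfl⟩ := Finset.mem_image.1 (Finsupp.mapDomain_support hk)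
    exact Finset.mem_range.2 i.isLt

end

/-! ### The theorem -/

theorem proposition3p1 (p e : ℕ) (hp : p.Prime) (he : 1 ≤ e)
    (F : Type*) [Field F] [Finite F] (hF : Nat.card F = p ^ e) :
    -- the Milnor basis elements `P(R)` are well defined
    (∀ (ℓ : ℕ) (R : Fin ℓ → ℕ), ∃! θ : SteenrodAlgebra F, IsMilnorElement R θ) ∧
    -- the May filtration of `P(r₁, …, r_ℓ)`
    (∀ (ℓ : ℕ) (R : Fin ℓ → ℕ) (θ : SteenrodAlgebra F), IsMilnorElement R θ →
      HasMayFiltration θ (∑ i : Fin ℓ, (i.val + 1) * digitSum p (R i))) ∧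
    -- the elements `P^s_t = P(0, …, 0, p ^ s)`
    (∀ (s t : ℕ), 1 ≤ t → ∀ θ : SteenrodAlgebra F,
      IsMilnorElement (fun i : Fin t => if i.val + 1 = t then p ^ s else 0) θ →
        HasMayFiltration θ t) := by
  have he0 : e ≠ 0 := by lia
  have hchar : CharP F p := by
    cases nonempty_fintype F
    obtain ⟨p', hp'⟩ := CharP.exists F
    obtain ⟨n, hn, hcard⟩ := FiniteField.card F p'
    rw [← Nat.card_eq_fintype_card, hF] at hcard
    have : p ∣ p' ^ (n : ℕ) := hcard ▸ dvd_pow_self p he0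
    rwa [(Nat.prime_dvd_prime_iff_eq hp hn).1 (hp.dvd_of_dvd_pow this)]
  have hinj := steenrodAction_injective F hp he0 hF
  have hop : ∀ {ℓ : ℕ} (R : Fin ℓ → ℕ), milnorOp F (Nat.card F) R =
      seqOp F (p ^ e) ((Finsupp.equivFunOnFinite.symm R).mapDomain Fin.val) := fun R => by
    rw [hF, milnorOp_eq_seqOp]
  have hfilt : ∀ (ℓ : ℕ) (R : Fin ℓ → ℕ) (θ : SteenrodAlgebra F), IsMilnorElement R θ →
      HasMayFiltration θ (∑ i : Fin ℓ, (i.val + 1) * digitSum p (R i)) := by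
    intro ℓ R θ hθ
    rw [IsMilnorElement, hop] at hθ
    rw [← digitWeight_mapDomain_val p (fun k => k + 1) R]
    constructor
    · obtain ⟨θ', h1, h2⟩ := exists_mem_augmentationIdeal_pow F hp he0 hF
        ((Finsupp.equivFunOnFinite.symm R).mapDomain Fin.val)
      rwa [hinj (hθ.trans h2.symm)]
    · intro h
      have h1 := steenrodAction_mem_weightSpan F hp he0 hF _ h
      rw [hθ] at h1
      -- The sequence of `R` has weight exactly `m`, so it is not among those of weight at least `m
      -- + 1`, and independence keeps `P(R)` out of their span.
      refine (linearIndependent_seqOp F (Nat.one_lt_pow he0 hp.one_lt)).notMem_span_image ?_ h1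
      exact Nat.not_succ_le_self _
  refine ⟨?_, hfilt, ?_⟩
  · intro ℓ R
    obtain ⟨θ, -, h⟩ := exists_mem_augmentationIdeal_pow F hp he0 hF
      ((Finsupp.equivFunOnFinite.symm R).mapDomain Fin.val)
    have h' : IsMilnorElement R θ := by rw [IsMilnorElement, hop, h]
    exact ⟨θ, h', fun θ' hθ' => hinj (Eq.trans hθ' h'.symm)⟩
  · intro s t ht θ hθ
    have h := hfilt t _ θ hθ
    obtain ⟨t, rfl⟩ : ∃ t', t = t' + 1 := ⟨t - 1, by lia⟩
    have e1 : ∑ i : Fin (t + 1), (i.val + 1) *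
        digitSum p (if i.val + 1 = t + 1 then p ^ s else 0) = t + 1 := by
      rw [Finset.sum_eq_single (Fin.last t)]
      · simp [digitSum_pow hp.one_lt]
      · intro i _ hi
        rw [if_neg, digitSum_zero, mul_zero]
        intro h'
        apply hi
        ext
        simp
        lia
      · simp
    rwa [e1] at h
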